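/- Let $n\ge 3$, $1\le k\le n$, and let $(M^n,g)$ be a compact Riemannian manifold with boundary ($M$ of class $C^4$, $g$ of class $C^3$; in particular this covers smooth $(M,g)$). Let $\sigma_j$ be the $j$-th elementary symmetric function of the eigenvalues, $\Gamma_k^+=\{\Lambda\in\mathbb R^n:\sigma_j(\Lambda)>0,\ 1\le j\le k\}$, $\bar\beta_{k,n}=(n-1)^k\binom nk$, and for a function $u$ on $M$ put $$\bar\nabla^2u=-Ric_g+(n-2)\nabla^2u+\Delta u\,g+(n-2)\big(|du|^2g-du\otimes du\big),$$ with eigenvalues taken with respect to $g$. A function $w\in C^2(M)$ is a subsolution of the $\sigma_k$-Ricci equation $\sigma_k(\bar\nabla^2w)=\bar\beta_{k,n}e^{2kw}$ if $\bar\nabla^2w\in\Gamma_k^+$ and $\sigma_k(\bar\nabla^2w)\ge\bar\beta_{k,n}e^{2kw}$ on $M$. Let $u_0\in C^3(M)$ be a subsolution of the $\sigma_k$-Ricci equation, let $T>0$, and let $u\in C^{3,2}(M\times[0,T))$ (three derivatives in $x$ and two in $t$, continuous on $M\times[0,T)$) satisfy $\bar\nabla^2u\in\Gamma_k^+$ and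 $$2k\,u_t=\log\sigma_k(\bar\nabla^2u)-\log\bar\beta_{k,n}-2ku\quad\text{on }M\times[0,T),$$ with $u(\cdot,0)=u_0$ and $u=\phi$ on $\partial M\times[0,T)$, where $\phi_t\ge0$ on $\partial M\times[0,T)$. Then: 1. $u_t\ge0$ on $M\times[0,T)$; in particular $t\mapsto u(x,t)$ is nondecreasing for each $x\in M$, and $u(\cdot,t)$ is a subsolution of the $\sigma_k$-Ricci equation for each $t\in[0,T)$. 2. For all $(x,t)\in M\times[0,T)$, $$u_t(x,t)\le C(t):=\max\Big\{\tfrac1{2k}\sup_M\big[\log\sigma_k(\bar\nabla^2u_0)-\log\bar\beta_{k,n}-2ku_0\big],\ \sup_{\partial M\times[0,t]}\phi_t\Big\},$$ where both suprema are finite (the second is omitted if $\partial M=\emptyset$), and $$u_0(x)\le u(x,t)\le u_0(x)+t\,C(t).$$ 3. If $\phi_t\le B$ on $\partial M\times[0,T)$ for a constant $B$, then the upper bounds in 2 for $u_t$ and $u$ hold on all of $M\times[0,T)$ with $C(t)$ replaced by the constant $\max\{\tfrac1{2k}\sup_M[\log\sigma_k(\bar\nabla^2u_0)-\log\bar\beta_{k,n}-2ku_0],\,B\}$.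 -/

import Mathlib

open Set Manifold
open scoped ContDiff

noncomputable section

namespace SigmaRicci

/-! ### Elementary symmetric functions of eigenvalues and the cone `Γ_k^+` -/

/-- `σ_k(A)`: the `k`-th elementary symmetric function of the eigenvalues of `A`, listed with
multiplicity (the real roots of the characteristic polynomial). It is used for matrices
`G⁻¹ * B` with `G` symmetric positive definite and `B` symmetric, all of whose eigenvalues
are real. -/
def sigma {n : ℕ} (k : ℕ) (A : Matrix (Fin n) (Fin n) ℝ) : ℝ :=
  A.charpoly.roots.esymm k

/-- The eigenvalues of `A` lie in `Γ_k^+`, i.e. `σ_j(A) > 0` for all `1 ≤ j ≤ k`. -/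
def InGammaPlus {n : ℕ} (k : ℕ) (A : Matrix (Fin n) (Fin n) ℝ) : Prop :=
  ∀ j : ℕ, 1 ≤ j → j ≤ k → 0 < sigma j A

/-- The constant `β̄_{k,n} = (n-1)^k * binom(n,k)`. -/
def betaBar (k n : ℕ) : ℝ := ((n : ℝ) - 1) ^ k * (n.choose k : ℝ)

/-! ### Riemannian geometry in coordinates on a manifold with boundary -/

/-- The partial derivative `∂_i f` on the closed half-space (one-sided at its boundary). -/
def pd {n : ℕ} [NeZero n] (i : Fin n) (f : EuclideanSpace ℝ (Fin n) → ℝ)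
    (y : EuclideanSpace ℝ (Fin n)) : ℝ :=
  fderivWithin ℝ f (range (𝓡∂ n)) y (EuclideanSpace.single i (1 : ℝ))

instance isManifold_one {n : ℕ} [NeZero n] {M : Type*} [TopologicalSpace M]
    [ChartedSpace (EuclideanHalfSpace n) M] [IsManifold (𝓡∂ n) 4 M] :
    IsManifold (𝓡∂ n) 1 M :=
  IsManifold.of_le (n := 4) (by norm_num)

/-- A Riemannian metric of class `C^3` on a manifold with boundary of class `C^4`. -/
abbrev Metric (n : ℕ) [NeZero n] (M : Type*) [TopologicalSpace M]
    [ChartedSpace (EuclideanHalfSpace n) M] [IsManifold (𝓡∂ n) 4 M] : Type _ :=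
  Bundle.ContMDiffRiemannianMetric (𝓡∂ n) 3 (EuclideanSpace ℝ (Fin n))
    (fun x : M => TangentSpace (𝓡∂ n) x)

section Geometry

variable {n : ℕ} [NeZero n] {M : Type*} [TopologicalSpace M]
  [ChartedSpace (EuclideanHalfSpace n) M]

/-- The coordinate vector field `∂_i` of the chart at `p`, at the point with coordinates `y`. -/
def coordVec (p : M) (i : Fin n) (y : EuclideanSpace ℝ (Fin n)) :
    TangentSpace (𝓡∂ n) ((extChartAt (𝓡∂ n) p).symm y) :=
  mfderivWithin 𝓘(ℝ, EuclideanSpace ℝ (Fin n)) (𝓡∂ n) (extChartAt (𝓡∂ n) p).symm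
    (range (𝓡∂ n)) y (EuclideanSpace.single i (1 : ℝ))

/-- The function `f` read in the chart at `p`. -/
def inChart (p : M) (f : M → ℝ) (y : EuclideanSpace ℝ (Fin n)) : ℝ :=
  f ((extChartAt (𝓡∂ n) p).symm y)

variable [IsManifold (𝓡∂ n) 4 M]

/-- The matrix `g_{ij}` of the metric in the chart at `p`, at the point with coordinates `y`. -/
def gMat (g : Metric n M) (p : M) (y : EuclideanSpace ℝ (Fin n)) : Matrix (Fin n) (Fin n) ℝ :=
  Matrix.of fun i j =>
    g.inner ((extChartAt (𝓡∂ n) p).symm y) (coordVec p i y) (coordVec p j y)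

/-- The Christoffel symbol
`Γ^k_{ij} = (1/2) g^{kl} (∂_i g_{jl} + ∂_j g_{il} - ∂_l g_{ij})`. -/
def christoffel (g : Metric n M) (p : M) (k i j : Fin n) (y : EuclideanSpace ℝ (Fin n)) : ℝ :=
  (1 / 2) * ∑ l, (gMat g p y)⁻¹ k l *
    (pd i (fun z => gMat g p z j l) y + pd j (fun z => gMat g p z i l) y
      - pd l (fun z => gMat g p z i j) y)

/-- The Ricci tensor
`R_{ij} = ∂_k Γ^k_{ij} - ∂_j Γ^k_{ik} + Γ^k_{kl} Γ^l_{ij} - Γ^k_{jl} Γ^l_{ik}`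
(positive on round spheres). -/
def ricci (g : Metric n M) (p : M) (y : EuclideanSpace ℝ (Fin n)) : Matrix (Fin n) (Fin n) ℝ :=
  Matrix.of fun i j =>
    ∑ k, (pd k (christoffel g p k i j) y - pd j (christoffel g p k i k) y)
      + ∑ k, ∑ l, (christoffel g p k k l y * christoffel g p l i j y
          - christoffel g p k j l y * christoffel g p l i k y)

/-- The Hessian `∇_i ∇_j f = ∂_i ∂_j f - Γ^k_{ij} ∂_k f`. -/
def hess (g : Metric n M) (f : M → ℝ) (p : M) (y : EuclideanSpace ℝ (Fin n)) :
    Matrix (Fin n) (Fin n) ℝ :=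
  Matrix.of fun i j =>
    pd i (pd j (inChart p f)) y - ∑ k, christoffel g p k i j y * pd k (inChart p f) y

/-- The Laplacian `Δ f = g^{ij} ∇_i ∇_j f`. -/
def lap (g : Metric n M) (f : M → ℝ) (p : M) (y : EuclideanSpace ℝ (Fin n)) : ℝ :=
  ∑ i, ∑ j, (gMat g p y)⁻¹ i j * hess g f p y i j

/-- `|df|^2 = g^{ij} ∂_i f ∂_j f`. -/
def gradSq (g : Metric n M) (f : M → ℝ) (p : M) (y : EuclideanSpace ℝ (Fin n)) : ℝ :=
  ∑ i, ∑ j, (gMat g p y)⁻¹ i j * (pd i (inChart p f) y * pd j (inChart p f) y)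

/-- The components of
`∇̄² u = -Ric_g + (n-2) ∇² u + (Δ u) g + (n-2) (|du|² g - du ⊗ du)`. -/
def barHess (g : Metric n M) (u : M → ℝ) (p : M) (y : EuclideanSpace ℝ (Fin n)) :
    Matrix (Fin n) (Fin n) ℝ :=
  Matrix.of fun i j =>
    -ricci g p y i j + ((n : ℝ) - 2) * hess g u p y i j + lap g u p y * gMat g p y i j
      + ((n : ℝ) - 2) * (gradSq g u p y * gMat g p y i j
          - pd i (inChart p u) y * pd j (inChart p u) y)

/-- The matrix of the endomorphism `g⁻¹ ∇̄² u` of `T_x M`, in the chart at `x`; its eigenvalues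
do not depend on the chart. -/
def barHessEnd (g : Metric n M) (u : M → ℝ) (x : M) : Matrix (Fin n) (Fin n) ℝ :=
  (gMat g x (extChartAt (𝓡∂ n) x x))⁻¹ * barHess g u x (extChartAt (𝓡∂ n) x x)

/-! ### The `σ_k`-Ricci equation and its flow -/

/-- `u ∈ C²(M)` is a subsolution of the `σ_k`-Ricci equation `σ_k(∇̄² u) = β̄_{k,n} e^{2ku}`:
`∇̄² u ∈ Γ_k^+` and `σ_k(∇̄² u) ≥ β̄_{k,n} e^{2ku}` on `M`. -/
structure IsSubsolution (g : Metric n M) (k : ℕ) (u : M → ℝ) : Prop where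
  contMDiff : ContMDiff (𝓡∂ n) 𝓘(ℝ, ℝ) 2 u
  mem_cone : ∀ x, InGammaPlus k (barHessEnd g u x)
  le_sigma : ∀ x, betaBar k n * Real.exp (2 * k * u x) ≤ sigma k (barHessEnd g u x)

/-- The time derivative on `[0,T)`, one-sided at `t = 0`. -/
def dt {X : Type*} (T : ℝ) (u : X → ℝ → ℝ) (x : X) (t : ℝ) : ℝ :=
  derivWithin (u x) (Ico 0 T) t

/-- The right-hand side of the flow divided by `2k`:
`(1/2k) (log σ_k(∇̄² u) - log β̄_{k,n} - 2ku)`. -/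
def speed (g : Metric n M) (k : ℕ) (u : M → ℝ) (x : M) : ℝ :=
  (1 / (2 * (k : ℝ))) *
    (Real.log (sigma k (barHessEnd g u x)) - Real.log (betaBar k n) - 2 * k * u x)

/-- `u` solves `2k u_t = log σ_k(∇̄² u) - log β̄_{k,n} - 2ku` on `M × [0,T)`, with
`∇̄² u ∈ Γ_k^+`. -/
structure IsFlowSolution (g : Metric n M) (k : ℕ) (T : ℝ) (u : M → ℝ → ℝ) : Prop where
  mem_cone : ∀ x, ∀ t ∈ Ico (0 : ℝ) T, InGammaPlus k (barHessEnd g (fun z => u z t) x)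
  eqn : ∀ x, ∀ t ∈ Ico (0 : ℝ) T,
    2 * k * dt T u x t = Real.log (sigma k (barHessEnd g (fun z => u z t) x))
      - Real.log (betaBar k n) - 2 * k * u x t

end Geometry

/-- `u ∈ C^{3,2}(M × [0,T))`: three derivatives in space and two in time, all of them
continuous on `M × [0,T)`. No mixed derivatives are required. -/
structure IsC32 {n : ℕ} [NeZero n] {M : Type*} [TopologicalSpace M]
    [ChartedSpace (EuclideanHalfSpace n) M] (T : ℝ) (u : M → ℝ → ℝ) : Prop where
  space : ∀ t ∈ Ico (0 : ℝ) T, ContMDiff (𝓡∂ n) 𝓘(ℝ, ℝ) 3 (fun x => u x t)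
  continuousOn_space : ∀ p : M, ∀ m : ℕ, m ≤ 3 →
    ContinuousOn
      (fun q : EuclideanSpace ℝ (Fin n) × ℝ =>
        iteratedFDerivWithin ℝ m (inChart p (fun x => u x q.2)) (range (𝓡∂ n)) q.1)
      ((extChartAt (𝓡∂ n) p).target ×ˢ Ico (0 : ℝ) T)
  time : ∀ x, ContDiffOn ℝ 2 (u x) (Ico (0 : ℝ) T)
  continuousOn_time : ∀ m : ℕ, m ≤ 2 →
    ContinuousOn (fun q : M × ℝ => iteratedDerivWithin m (u q.1) (Ico (0 : ℝ) T) q.2)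
      (univ ×ˢ Ico (0 : ℝ) T)

/-- The constant `max { sup_M (1/2k)(log σ_k(∇̄² u₀) - log β̄_{k,n} - 2k u₀), sup_{∂M × [0,t]} φ_t }`. -/
def speedBound {n : ℕ} [NeZero n] {M : Type*} [TopologicalSpace M]
    [ChartedSpace (EuclideanHalfSpace n) M] [IsManifold (𝓡∂ n) 4 M]
    (g : Metric n M) (k : ℕ) (T : ℝ) (u₀ : M → ℝ)
    (φ : (𝓡∂ n).boundary M → ℝ → ℝ) (t : ℝ) : ℝ :=
  max (⨆ x, speed g k u₀ x) (⨆ q : (𝓡∂ n).boundary M × Icc (0 : ℝ) t, dt T φ q.1 q.2)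

end SigmaRicci

end

namespace SigmaRicci

/-! ### Newton's inequality for real-rooted polynomials -/

/-! Everything rests on a comparison principle for the flow, applied to time translates of `u`.
Differentiating the equation in `t` is not possible: `IsC32` provides no mixed derivatives, so `u_t`
need not have two derivatives in `x`. Differences `u(t+h) - u(t)` need none.

Suppose `v - w` has a positive maximum over `M × [0,τ]`, away from time zero and from the boundary.
There the gradients agree and the Hessian of `v - w` is nonpositive, so `∇̄² w - ∇̄² v` is positive
semidefinite. Since `σ_k` is monotone on `Γ_k^+`, the speed of `v` is at most that of `w` minus `v -
w`; the last term comes from `-2ku` and makes the inequality strict. This contradicts a nonnegative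
time derivative (`le_of_parabolic_comparison`).

Comparing the stationary `u₀` with `u` gives `u₀ ≤ u`; comparing `u(t)` with `u(t+h)` then gives
monotonicity, hence `u_t ≥ 0`. For the upper bound, `u₀ + tC` is a barrier, so `u(h) ≤ u₀ + hC`;
comparing `u(t+h)` with `u(t) + hC` then bounds the difference quotients by `C`.

Monotonicity of `σ_k` is algebraic. A rank-one term `v vᵀ` adds to `σ_j` a combination, with squares
as coefficients, of the `σ_{j-1}` of the spectrum with one eigenvalue removed. These are positive on
`Γ_k^+` by Newton's inequality, and a positive semidefinite matrix is a sum of rank-one terms. -/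

open Polynomial in
theorem two_mul_coeff_mul_coeff_le_of_multiset (s : Multiset ℝ) :
    2 * (s.map fun t => X - C t).prod.coeff 0 * (s.map fun t => X - C t).prod.coeff 2
      ≤ (s.map fun t => X - C t).prod.coeff 1 ^ 2 := by
  induction s using Multiset.induction_on with
  | empty => simp [coeff_one]
  | cons a s ih =>
    set q := (s.map fun t => X - C t).prod
    have h0 : ((X - C a) * q).coeff 0 = -a * q.coeff 0 := by simp [sub_mul]
    have h1 : ((X - C a) * q).coeff 1 = q.coeff 0 - a * q.coeff 1 := by
      simp [sub_mul, coeff_X_mul]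
    have h2 : ((X - C a) * q).coeff 2 = q.coeff 1 - a * q.coeff 2 := by
      simp [sub_mul, coeff_X_mul]
    rw [Multiset.map_cons, Multiset.prod_cons, h0, h1, h2]
    -- With `q_i` the coefficients of `q`, the new value of `c₁² - 2c₀c₂` is exactly `q₀² + a²(q₁² -
    -- 2q₀q₂)`.
    nlinarith [sq_nonneg (q.coeff 0), mul_le_mul_of_nonneg_left ih (sq_nonneg a)]

open Polynomial in
/-- Laguerre's inequality at the origin. -/
theorem two_mul_coeff_mul_coeff_le {p : ℝ[X]} (hp : p.Splits) :
    2 * p.coeff 0 * p.coeff 2 ≤ p.coeff 1 ^ 2 := by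
  rw [← C_leadingCoeff_mul_prod_multiset_X_sub_C (splits_iff_card_roots.1 hp)]
  simp only [coeff_C_mul]
  nlinarith [mul_le_mul_of_nonneg_left (two_mul_coeff_mul_coeff_le_of_multiset p.roots)
    (sq_nonneg p.leadingCoeff)]

-- Rolle: differentiation loses at most one root counted with multiplicity, and lowers the degree by
-- at least one unless the polynomial is constant.
open Polynomial in
theorem splits_derivative {p : ℝ[X]} (hp : p.Splits) : (derivative p).Splits := by
  rw [splits_iff_card_roots] at hp ⊢
  have h1 := card_roots_le_derivative p
  have h2 := card_roots' (derivative p)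
  have h3 := natDegree_derivative_le p
  rcases Nat.eq_zero_or_pos p.natDegree with h | h
  · have := derivative_of_natDegree_zero h
    simp [this]
  · omega

open Polynomial in
theorem splits_iterate_derivative {p : ℝ[X]} (hp : p.Splits) (m : ℕ) :
    (derivative^[m] p).Splits := by
  induction m with
  | zero => exact hp
  | succ m ih => rw [Function.iterate_succ_apply']; exact splits_derivative ih

open Polynomial in
/-- A weak form of Newton's inequality for the coefficients of a real-rooted polynomial. -/
theorem coeff_mul_coeff_le {p : ℝ[X]} (hp : p.Splits) (m : ℕ) :
    p.coeff m * p.coeff (m + 2) ≤ p.coeff (m + 1) ^ 2 := by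
  have h := two_mul_coeff_mul_coeff_le (splits_iterate_derivative hp m)
  simp only [coeff_iterate_derivative, nsmul_eq_mul] at h
  have e0 : (0 + m).descFactorial m = m.factorial := by simp [Nat.descFactorial_self]
  have e1 : (1 + m).descFactorial m = (m + 1) * m.factorial := by
    rw [Nat.descFactorial_eq_factorial_mul_choose, add_comm 1 m, Nat.choose_succ_self_right,
      mul_comm]
  have e2 : 2 * (2 + m).descFactorial m = (m + 2) * (m + 1) * m.factorial := by
    have := Nat.factorial_mul_descFactorial (n := 2 + m) (k := m) (by omega)
    simp only [Nat.add_sub_cancel, Nat.factorial_two] at this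
    rw [this, add_comm 2 m, Nat.factorial_succ, Nat.factorial_succ]; ring
  have e2' : 2 * ((2 + m).descFactorial m : ℝ) = (m + 2) * (m + 1) * m.factorial := by
    exact_mod_cast e2
  rw [e0, e1, zero_add, add_comm 1 m, add_comm 2 m] at h
  rw [add_comm 2 m] at e2'
  push_cast at h
  have hf : (0 : ℝ) < m.factorial := by exact_mod_cast m.factorial_pos
  have h' : ((m.factorial : ℝ) ^ 2 * (m + 1)) * ((m + 2) * (p.coeff m * p.coeff (m + 2)))
      ≤ ((m.factorial : ℝ) ^ 2 * (m + 1)) * ((m + 1) * p.coeff (m + 1) ^ 2) := by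
    calc _ = (m.factorial * p.coeff m) * ((m + 2) * (m + 1) * m.factorial) * p.coeff (m + 2) := by
            ring
      _ ≤ ((m + 1) * m.factorial * p.coeff (m + 1)) ^ 2 := by rw [← e2']; linarith
      _ = _ := by ring
  have h2 := le_of_mul_le_mul_left h' (by positivity)
  have hm : (0 : ℝ) ≤ m := m.cast_nonneg
  -- Laguerre for the `m`-th derivative gives `(m+2) c_m c_{m+2} ≤ (m+1) c_{m+1}²`; the sharper
  -- constant is dropped.
  rcases le_or_gt (p.coeff m * p.coeff (m + 2)) 0 with h0 | h0
  · exact h0.trans (sq_nonneg _)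
  · nlinarith

open Polynomial in
theorem esymm_mul_esymm_le (s : Multiset ℝ) (j : ℕ) :
    s.esymm j * s.esymm (j + 2) ≤ s.esymm (j + 1) ^ 2 := by
  rcases le_or_gt (j + 2) (Multiset.card s) with h | h
  · obtain ⟨m, hm⟩ := Nat.exists_eq_add_of_le h
    have hp : (s.map fun t => X - C t).prod.Splits := by
      apply Polynomial.Splits.multisetProd
      intro q hq
      obtain ⟨t, -, rfl⟩ := Multiset.mem_map.1 hq
      exact Polynomial.Splits.X_sub_C t
    have h1 := coeff_mul_coeff_le hp m
    rw [Multiset.prod_X_sub_C_coeff s (k := m) (by omega),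
      Multiset.prod_X_sub_C_coeff s (k := m + 1) (by omega),
      Multiset.prod_X_sub_C_coeff s (k := m + 2) (by omega),
      show Multiset.card s - m = j + 2 by omega, show Multiset.card s - (m + 1) = j + 1 by omega,
      show Multiset.card s - (m + 2) = j by omega] at h1
    have e : ((-1 : ℝ) ^ j) ^ 2 = 1 := by rw [← pow_mul, mul_comm, pow_mul]; simp
    calc _ = ((-1 : ℝ) ^ j) ^ 2 * (s.esymm j * s.esymm (j + 2)) := by rw [e, one_mul]
      _ = (-1) ^ (j + 2) * s.esymm (j + 2) * ((-1) ^ j * s.esymm j) := by ring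
      _ ≤ _ := h1
      _ = ((-1 : ℝ) ^ j) ^ 2 * s.esymm (j + 1) ^ 2 := by ring
      _ = _ := by rw [e, one_mul]
  · have : s.esymm (j + 2) = 0 := by
      rw [Multiset.esymm, Multiset.powersetCard_eq_empty _ h]; simp
    rw [this, mul_zero]; exact sq_nonneg _

/-! ### The cone `Γ_k^+` -/

theorem esymm_cons {R : Type*} [CommSemiring R] (a : R) (s : Multiset R) (j : ℕ) :
    (a ::ₘ s).esymm (j + 1) = s.esymm (j + 1) + a * s.esymm j := by
  simp [Multiset.esymm, Multiset.powersetCard_cons, Multiset.map_map,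
    Multiset.sum_map_mul_left]

theorem multiset_esymm_zero {R : Type*} [CommSemiring R] (s : Multiset R) : s.esymm 0 = 1 := by
  simp [Multiset.esymm]

/-- Removing an eigenvalue from a point of `Γ_k^+` leaves a point of `Γ_{k-1}^+`. -/
theorem esymm_pos_of_cons {k : ℕ} {a : ℝ} {s : Multiset ℝ}
    (h : ∀ j, 1 ≤ j → j ≤ k → 0 < (a ::ₘ s).esymm j) (j : ℕ) (hj : j < k) : 0 < s.esymm j := by
  induction j with
  | zero => simp [multiset_esymm_zero]
  | succ j ih =>
    have ih := ih (by omega)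
    by_contra! hneg
    -- Write `e_i` for `s.esymm i` and assume `e_{j+1} ≤ 0 < e_j`. Then `a e_j > -e_{j+1}` and
    -- `e_{j+2} > -a e_{j+1}`, so `e_j e_{j+2} > e_{j+1}²`, against Newton.
    have h1 := h (j + 1) (by omega) (by omega)
    have h2 := h (j + 2) (by omega) (by omega)
    rw [esymm_cons] at h1 h2
    have hN := esymm_mul_esymm_le s j
    have ha : 0 < a := by
      by_contra! ha
      nlinarith [mul_nonneg (neg_nonneg.2 ha) ih.le]
    have h3 : s.esymm j * (-(a * s.esymm (j + 1))) < s.esymm j * s.esymm (j + 2) :=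
      mul_lt_mul_of_pos_left (by linarith) ih
    nlinarith

/-! ### Symmetric matrices under rank-one perturbations -/

section RankOne

variable {n : ℕ}

open Matrix

theorem det_diagonal_add_vecMulVec {a : Fin n → ℝ} (ha : ∀ i, a i ≠ 0) (u v : Fin n → ℝ) :
    (diagonal a + vecMulVec u v).det
      = ∏ i, a i + ∑ i, u i * v i * ∏ j ∈ Finset.univ.erase i, a j := by
  have hu : IsUnit (diagonal a).det := by
    rw [det_diagonal, isUnit_iff_ne_zero]; exact Finset.prod_ne_zero_iff.2 fun i _ => ha i
  have hinv : (diagonal a)⁻¹ = diagonal (fun i => (a i)⁻¹) := by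
    apply inv_eq_right_inv
    rw [diagonal_mul_diagonal, ← diagonal_one]
    congr 1; ext i; exact mul_inv_cancel₀ (ha i)
  rw [vecMulVec_eq Unit, det_add_replicateCol_mul_replicateRow hu, hinv, det_diagonal,
    det_unique, Matrix.add_apply, mul_add]
  simp only [one_apply_eq, mul_one, add_right_inj]
  rw [Matrix.mul_apply]
  simp only [mul_diagonal, replicateRow_apply, replicateCol_apply, Finset.mul_sum]
  refine Finset.sum_congr rfl fun i _ => ?_
  rw [← Finset.mul_prod_erase _ a (Finset.mem_univ i)]
  field_simp [ha i]

open Polynomial in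
theorem charpoly_diagonal_add_vecMulVec (d w : Fin n → ℝ) :
    (diagonal d + vecMulVec w w).charpoly
      = ∏ i, (X - C (d i)) - ∑ i, C (w i ^ 2) * ∏ j ∈ Finset.univ.erase i, (X - C (d j)) := by
  -- The determinant formula needs an invertible diagonal part, so the polynomials are compared only
  -- at the infinitely many `t` that avoid every `d i`.
  refine Polynomial.eq_of_infinite_eval_eq _ _ ((Set.finite_range d).infinite_compl.mono ?_)
  intro t ht
  have hne : ∀ i, t - d i ≠ 0 := fun i h => ht ⟨i, by linarith⟩
  have e : Matrix.scalar (Fin n) t - (diagonal d + vecMulVec w w)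
      = diagonal (fun i => t - d i) + vecMulVec (-w) w := by
    rw [← sub_sub, neg_vecMulVec, ← sub_eq_add_neg]
    congr 1
    rw [← diagonal_sub]; rfl
  rw [Set.mem_ofPred_eq, eval_charpoly, e, det_diagonal_add_vecMulVec hne]
  simp only [eval_sub, eval_prod, eval_X, eval_C, eval_finsetSum, eval_mul, Pi.neg_apply]
  rw [sub_eq_add_neg, ← Finset.sum_neg_distrib]
  congr 1
  refine Finset.sum_congr rfl fun i _ => ?_
  ring

theorem sigma_congr {A B : Matrix (Fin n) (Fin n) ℝ} (h : A.charpoly = B.charpoly) (j : ℕ) :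
    sigma j A = sigma j B := by
  rw [sigma, sigma, h]

theorem sigma_of_isHermitian {A : Matrix (Fin n) (Fin n) ℝ} (hA : A.IsHermitian) (j : ℕ) :
    sigma j A = (Finset.univ.val.map hA.eigenvalues).esymm j := by
  rw [sigma, hA.roots_charpoly_eq_eigenvalues]; rfl

open Polynomial in
theorem coeff_prod_X_sub_C (s : Finset (Fin n)) (d : Fin n → ℝ) {j m : ℕ} (h : m + j = s.card) :
    (∏ i ∈ s, (X - C (d i))).coeff m = (-1) ^ j * (s.val.map d).esymm j := by
  have e : ∏ i ∈ s, (X - C (d i)) = ((s.val.map d).map fun t => X - C t).prod := by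
    rw [Multiset.map_map]; rfl
  have hc : Multiset.card (s.val.map d) = s.card := by simp
  rw [e, Multiset.prod_X_sub_C_coeff _ (by omega), hc, show s.card - m = j by omega]

open Polynomial in
theorem coeff_charpoly_eq_sigma {A : Matrix (Fin n) (Fin n) ℝ} (hA : A.IsHermitian) {j m : ℕ}
    (h : m + j = n) : A.charpoly.coeff m = (-1) ^ j * sigma j A := by
  rw [sigma_of_isHermitian hA, hA.charpoly_eq]
  exact coeff_prod_X_sub_C Finset.univ hA.eigenvalues (by simpa using h)

theorem isHermitian_vecMulVec_self (v : Fin n → ℝ) : (vecMulVec v v).IsHermitian := by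
  ext i j; simp [vecMulVec_apply, mul_comm]

/-- In an eigenbasis of `S` the perturbation is `w wᵀ`, with `w` the coordinates of `v`. The
characteristic polynomial is then affine in the `w i ^ 2`, and its coefficients give the formula. -/
theorem exists_sigma_add_vecMulVec {S : Matrix (Fin n) (Fin n) ℝ} (hS : S.IsHermitian)
    (v : Fin n → ℝ) : ∃ w : Fin n → ℝ, ∀ j, j + 1 ≤ n →
      sigma (j + 1) (S + vecMulVec v v) = sigma (j + 1) S
        + ∑ i, w i ^ 2 * ((Finset.univ.erase i).val.map hS.eigenvalues).esymm j := by
  let U : Matrix (Fin n) (Fin n) ℝ := hS.eigenvectorUnitary.val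
  have hUU : U * star U = 1 := Unitary.coe_mul_star_self _
  have hdiag : star U * S * U = diagonal hS.eigenvalues := by
    have := hS.conjStarAlgAut_star_eigenvectorUnitary
    rw [Unitary.conjStarAlgAut_star_apply] at this
    exact this
  refine ⟨star U *ᵥ v, fun j hj => ?_⟩
  have hw : v ᵥ* U = star U *ᵥ v := by
    rw [star_eq_conjTranspose, conjTranspose_eq_transpose_of_trivial, mulVec_transpose]
  have hch : (S + vecMulVec v v).charpoly
      = (diagonal hS.eigenvalues + vecMulVec (star U *ᵥ v) (star U *ᵥ v)).charpoly := by
    have e : diagonal hS.eigenvalues + vecMulVec (star U *ᵥ v) (star U *ᵥ v)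
        = star U * ((S + vecMulVec v v) * U) := by
      rw [← hdiag, add_mul, mul_add, vecMulVec_mul, mul_vecMulVec, hw, Matrix.mul_assoc]
    rw [e, charpoly_mul_comm, Matrix.mul_assoc, hUU, Matrix.mul_one]
  have hS' : (S + vecMulVec v v).IsHermitian := hS.add (isHermitian_vecMulVec_self v)
  obtain ⟨m, rfl⟩ := Nat.exists_eq_add_of_le' hj
  have h1 := coeff_charpoly_eq_sigma hS' (m := m) (j := j + 1) rfl
  have h2 : ∀ i : Fin (m + (j + 1)), _ := fun i =>
    coeff_prod_X_sub_C (Finset.univ.erase i) hS.eigenvalues (m := m) (j := j) (by simp)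
  rw [hch, charpoly_diagonal_add_vecMulVec, Polynomial.coeff_sub,
    coeff_prod_X_sub_C Finset.univ hS.eigenvalues (j := j + 1) (by simp),
    Polynomial.finsetSum_coeff] at h1
  simp only [Polynomial.coeff_C_mul, h2] at h1
  rw [sigma_of_isHermitian hS]
  have hne : ((-1 : ℝ) ^ (j + 1)) ≠ 0 := by simp
  apply mul_left_cancel₀ hne
  rw [← h1, mul_add, Finset.mul_sum, sub_eq_add_neg, ← Finset.sum_neg_distrib]
  congr 1
  refine Finset.sum_congr rfl fun i _ => ?_
  ring

theorem sigma_le_sigma_add_vecMulVec {k : ℕ} (hk : k ≤ n) {S : Matrix (Fin n) (Fin n) ℝ}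
    (hS : S.IsHermitian) (hG : InGammaPlus k S) (v : Fin n → ℝ) {j : ℕ} (h1 : 1 ≤ j)
    (hj : j ≤ k) : sigma j S ≤ sigma j (S + vecMulVec v v) := by
  obtain ⟨w, hw⟩ := exists_sigma_add_vecMulVec hS v
  obtain ⟨i, rfl⟩ := Nat.exists_eq_add_of_le' h1
  rw [hw i (by omega)]
  refine le_add_of_nonneg_right (Finset.sum_nonneg fun l _ => ?_)
  refine mul_nonneg (sq_nonneg _) (esymm_pos_of_cons (k := k) (a := hS.eigenvalues l) ?_ i hj).le
  intro r hr1 hr2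
  have e : hS.eigenvalues l ::ₘ (Finset.univ.erase l).val.map hS.eigenvalues
      = Finset.univ.val.map hS.eigenvalues := by
    rw [← Multiset.map_cons, Finset.erase_val, Multiset.cons_erase (Finset.mem_univ_val l)]
  rw [e, ← sigma_of_isHermitian hS]
  exact hG r hr1 hr2

/-- All `j ≤ k` are treated together because the induction must keep each partial sum in `Γ_k^+`. -/
theorem sigma_le_sigma_add_sum_vecMulVec {k : ℕ} (hk : k ≤ n) {S : Matrix (Fin n) (Fin n) ℝ}
    (hS : S.IsHermitian) (hG : InGammaPlus k S) {ι : Type*} (s : Finset ι) (v : ι → Fin n → ℝ) :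
    (S + ∑ r ∈ s, vecMulVec (v r) (v r)).IsHermitian ∧
      ∀ j, 1 ≤ j → j ≤ k → sigma j S ≤ sigma j (S + ∑ r ∈ s, vecMulVec (v r) (v r)) := by
  classical
  induction s using Finset.induction_on with
  | empty => simpa using hS
  | insert a s ha ih =>
    rw [Finset.sum_insert ha, add_comm (vecMulVec _ _), ← add_assoc]
    refine ⟨ih.1.add (isHermitian_vecMulVec_self _), fun j h1 hj => (ih.2 j h1 hj).trans ?_⟩
    exact sigma_le_sigma_add_vecMulVec hk ih.1
      (fun i hi hik => (hG i hi hik).trans_le (ih.2 i hi hik)) _ h1 hj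

open scoped MatrixOrder in
theorem exists_eq_conjTranspose_mul_self {P : Matrix (Fin n) (Fin n) ℝ} (hP : P.PosSemidef) :
    ∃ D : Matrix (Fin n) (Fin n) ℝ, P = Dᴴ * D :=
  CStarAlgebra.nonneg_iff_eq_star_mul_self.1 hP.nonneg

theorem sigma_le_sigma_add_posSemidef {k : ℕ} (hk : k ≤ n) {S P : Matrix (Fin n) (Fin n) ℝ}
    (hS : S.IsHermitian) (hG : InGammaPlus k S) (hP : P.PosSemidef) {j : ℕ} (h1 : 1 ≤ j)
    (hj : j ≤ k) : sigma j S ≤ sigma j (S + P) := by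
  obtain ⟨D, rfl⟩ := exists_eq_conjTranspose_mul_self hP
  have e : Dᴴ * D = ∑ r, vecMulVec (D r) (D r) := by
    ext a b
    simp [Matrix.mul_apply, Matrix.sum_apply, vecMulVec_apply]
  rw [e]
  exact (sigma_le_sigma_add_sum_vecMulVec hk hS hG Finset.univ D).2 j h1 hj

/-- Monotonicity of `σ_k` on `Γ_k^+`: adding a positive semidefinite form does not decrease it. -/
theorem sigma_inv_mul_le {k : ℕ} (hk1 : 1 ≤ k) (hk : k ≤ n) {G B P : Matrix (Fin n) (Fin n) ℝ}
    (hG : G.PosDef) (hB : B.IsHermitian) (hP : P.PosSemidef) (hcone : InGammaPlus k (G⁻¹ * B)) :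
    sigma k (G⁻¹ * B) ≤ sigma k (G⁻¹ * (B + P)) := by
  obtain ⟨D, hD⟩ := exists_eq_conjTranspose_mul_self hG.inv.posSemidef
  -- With `G⁻¹ = Dᴴ D`, cyclicity of the characteristic polynomial replaces the nonsymmetric `G⁻¹ A`
  -- by a congruence of `A`.
  have key : ∀ A : Matrix (Fin n) (Fin n) ℝ, ∀ j, sigma j (G⁻¹ * A) = sigma j (D * A * Dᴴ) := by
    intro A j
    apply sigma_congr
    rw [hD, Matrix.mul_assoc, charpoly_mul_comm]
  rw [key, key, mul_add, add_mul]
  refine sigma_le_sigma_add_posSemidef hk ?_ (fun j h1 hj => ?_)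
    (hP.mul_mul_conjTranspose_same D) hk1 le_rfl
  · exact isHermitian_mul_mul_conjTranspose D hB
  · rw [← key]; exact hcone j h1 hj

end RankOne

/-! ### Coordinate derivatives at interior points of the half-space -/

section Calculus

open Filter Topology

variable {n : ℕ} [NeZero n] {y : EuclideanSpace ℝ (Fin n)}

/-- The maximum principle is used only at interior points, where one-sided derivatives are ordinary
ones. -/
theorem pd_eq_fderiv (hy : y ∈ interior (range (𝓡∂ n))) (i : Fin n)
    (f : EuclideanSpace ℝ (Fin n) → ℝ) :
    pd i f y = fderiv ℝ f y (EuclideanSpace.single i 1) := by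
  rw [pd, fderivWithin_of_mem_nhds (mem_interior_iff_mem_nhds.1 hy)]

theorem pd_eventuallyEq_fderiv (hy : y ∈ interior (range (𝓡∂ n))) (i : Fin n)
    (f : EuclideanSpace ℝ (Fin n) → ℝ) :
    pd i f =ᶠ[𝓝 y] fun z => fderiv ℝ f z (EuclideanSpace.single i 1) := by
  filter_upwards [isOpen_interior.mem_nhds hy] with z hz
  exact pd_eq_fderiv hz i f

theorem pd_congr (hy : y ∈ interior (range (𝓡∂ n))) (i : Fin n)
    {f h : EuclideanSpace ℝ (Fin n) → ℝ} (hfh : f =ᶠ[𝓝 y] h) : pd i f y = pd i h y := by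
  rw [pd_eq_fderiv hy, pd_eq_fderiv hy, hfh.fderiv_eq]

theorem contDiffAt_pd (hy : y ∈ interior (range (𝓡∂ n))) (i : Fin n) {m : ℕ}
    {f : EuclideanSpace ℝ (Fin n) → ℝ} (hf : ContDiffAt ℝ (m + 1) f y) :
    ContDiffAt ℝ m (pd i f) y :=
  ((hf.fderiv_right le_rfl).clm_apply contDiffAt_const).congr_of_eventuallyEq
    (pd_eventuallyEq_fderiv hy i f)

theorem pd_const (hy : y ∈ interior (range (𝓡∂ n))) (i : Fin n) (c : ℝ) :
    pd i (fun _ => c) y = 0 := by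
  simp [pd_eq_fderiv hy]

theorem pd_const_mul (hy : y ∈ interior (range (𝓡∂ n))) (i : Fin n) (c : ℝ)
    {f : EuclideanSpace ℝ (Fin n) → ℝ} (hf : DifferentiableAt ℝ f y) :
    pd i (fun z => c * f z) y = c * pd i f y := by
  rw [pd_eq_fderiv hy, pd_eq_fderiv hy, fderiv_const_mul hf]; rfl

theorem pd_sub (hy : y ∈ interior (range (𝓡∂ n))) (i : Fin n)
    {f h : EuclideanSpace ℝ (Fin n) → ℝ} (hf : DifferentiableAt ℝ f y)
    (hh : DifferentiableAt ℝ h y) : pd i (fun z => f z - h z) y = pd i f y - pd i h y := by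
  rw [pd_eq_fderiv hy, pd_eq_fderiv hy, pd_eq_fderiv hy, fderiv_fun_sub hf hh]; rfl

theorem pd_mul (hy : y ∈ interior (range (𝓡∂ n))) (i : Fin n)
    {f h : EuclideanSpace ℝ (Fin n) → ℝ} (hf : DifferentiableAt ℝ f y)
    (hh : DifferentiableAt ℝ h y) :
    pd i (fun z => f z * h z) y = pd i f y * h y + f y * pd i h y := by
  rw [pd_eq_fderiv hy, pd_eq_fderiv hy, pd_eq_fderiv hy, fderiv_fun_mul hf hh]
  simp only [add_apply, smul_apply, smul_eq_mul]
  ring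

theorem pd_sum (hy : y ∈ interior (range (𝓡∂ n))) (i : Fin n) {ι : Type*} (s : Finset ι)
    {f : ι → EuclideanSpace ℝ (Fin n) → ℝ} (hf : ∀ a ∈ s, DifferentiableAt ℝ (f a) y) :
    pd i (fun z => ∑ a ∈ s, f a z) y = ∑ a ∈ s, pd i (f a) y := by
  rw [pd_eq_fderiv hy, fderiv_fun_sum hf]
  simp [pd_eq_fderiv hy]

theorem pd_pd_eq (hy : y ∈ interior (range (𝓡∂ n))) (i j : Fin n)
    {f : EuclideanSpace ℝ (Fin n) → ℝ} (hf : ContDiffAt ℝ 2 f y) :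
    pd i (pd j f) y = fderiv ℝ (fderiv ℝ f) y (EuclideanSpace.single i 1)
      (EuclideanSpace.single j 1) := by
  have hd : DifferentiableAt ℝ (fderiv ℝ f) y :=
    (hf.fderiv_right (m := 1) le_rfl).differentiableAt one_ne_zero
  rw [pd_congr hy i (pd_eventuallyEq_fderiv hy j f), pd_eq_fderiv hy,
    fderiv_clm_apply hd (differentiableAt_const _)]
  simp

theorem pd_comm (hy : y ∈ interior (range (𝓡∂ n))) (i j : Fin n)
    {f : EuclideanSpace ℝ (Fin n) → ℝ} (hf : ContDiffAt ℝ 2 f y) :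
    pd i (pd j f) y = pd j (pd i f) y := by
  rw [pd_pd_eq hy i j hf, pd_pd_eq hy j i hf]
  exact (hf.isSymmSndFDerivAt (by simp)).eq _ _

/-- The second-order necessary condition at a local maximum. -/
theorem fderiv_fderiv_nonpos_of_isLocalMax {E : Type*} [NormedAddCommGroup E] [NormedSpace ℝ E]
    {f : E → ℝ} {y : E} (hf : ContDiffAt ℝ 2 f y) (hmax : IsLocalMax f y) (v : E) :
    fderiv ℝ (fderiv ℝ f) y v v ≤ 0 := by
  by_contra! hpos
  set l : ℝ → E := fun t => y + t • v with hl
  have hl0 : l 0 = y := by simp [hl]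
  have hld : ∀ t, HasDerivAt l v t := fun t => by
    simpa [hl] using ((hasDerivAt_id t).smul_const v).const_add y
  have hlc : Tendsto l (𝓝 0) (𝓝 y) := by
    have := (hld 0).continuousAt.tendsto
    rwa [hl0] at this
  have hd1 : deriv (f ∘ l) =ᶠ[𝓝 0] fun t => fderiv ℝ f (l t) v := by
    have : ∀ᶠ z in 𝓝 y, ContDiffAt ℝ 2 f z := hf.eventually (by simp)
    filter_upwards [hlc.eventually this] with t ht
    exact ((ht.differentiableAt two_ne_zero).hasFDerivAt.comp_hasDerivAt t (hld t)).deriv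
  have hd : DifferentiableAt ℝ (fderiv ℝ f) (l 0) := by
    rw [hl0]; exact (hf.fderiv_right (m := 1) le_rfl).differentiableAt one_ne_zero
  have hd2 : deriv (deriv (f ∘ l)) 0 = fderiv ℝ (fderiv ℝ f) y v v := by
    rw [hd1.deriv_eq]
    have h1 := hd.hasFDerivAt.comp_hasDerivAt 0 (hld 0)
    have h2 := h1.clm_apply (hasDerivAt_const (0 : ℝ) v)
    have h3 := h2.deriv
    simp only [hl0, map_zero, add_zero, Function.comp_def] at h3
    exact h3
  have hmax' : IsLocalMax (f ∘ l) 0 := by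
    have : ∀ᶠ z in 𝓝 y, f z ≤ f y := hmax
    have h := hlc.eventually this
    rw [← hl0] at h
    exact h
  -- A positive second derivative along the line makes the maximum also a minimum; the restriction
  -- is then locally constant, and its second derivative vanishes.
  have hmin : IsLocalMin (f ∘ l) 0 := by
    refine isLocalMin_of_deriv_deriv_pos (hd2 ▸ hpos) hmax'.deriv_eq_zero ?_
    have h1 : ContinuousAt f (l 0) := by rw [hl0]; exact hf.continuousAt
    exact h1.comp (hld 0).continuousAt
  have hconst : (f ∘ l) =ᶠ[𝓝 0] fun _ => (f ∘ l) 0 := by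
    filter_upwards [hmax', hmin] with t h1 h2
    exact le_antisymm h1 h2
  have : deriv (deriv (f ∘ l)) 0 = 0 := by
    rw [(hconst.deriv).deriv_eq]; simp
  linarith

theorem posSemidef_neg_pd_pd_of_isLocalMax (hy : y ∈ interior (range (𝓡∂ n)))
    {f : EuclideanSpace ℝ (Fin n) → ℝ} (hf : ContDiffAt ℝ 2 f y) (hmax : IsLocalMax f y) :
    (Matrix.of fun i j => -pd i (pd j f) y).PosSemidef := by
  refine Matrix.PosSemidef.of_dotProduct_mulVec_nonneg ?_ fun v => ?_
  · ext i j
    simp [pd_comm hy i j hf]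
  · have h := fderiv_fderiv_nonpos_of_isLocalMax hf hmax
      (∑ i, v i • EuclideanSpace.single i (1 : ℝ))
    simp only [map_sum, map_smul, sum_apply, smul_apply,
      smul_eq_mul] at h
    simp only [← pd_pd_eq hy _ _ hf] at h
    refine (neg_nonneg.2 h).trans_eq ?_
    simp only [dotProduct, Matrix.mulVec, Matrix.of_apply, star_trivial, Finset.mul_sum,
      ← Finset.sum_neg_distrib]
    rw [Finset.sum_comm]
    refine Finset.sum_congr rfl fun i _ => Finset.sum_congr rfl fun j _ => ?_
    ring

end Calculus

/-! ### Regularity and positivity of the metric coefficients in a chart. -/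

section MetricCoordinates

open Filter Topology Bundle

variable {n : ℕ} [NeZero n] {M : Type*} [TopologicalSpace M]
  [ChartedSpace (EuclideanHalfSpace n) M]

theorem contDiffAt_inChart {p : M} (hp : extChartAt (𝓡∂ n) p p ∈ interior (range (𝓡∂ n)))
    {m : ℕ∞ω} {f : M → ℝ} (hf : ContMDiffAt (𝓡∂ n) 𝓘(ℝ, ℝ) m f p) :
    ContDiffAt ℝ m (inChart p f) (extChartAt (𝓡∂ n) p p) := by
  have h := (contMDiffAt_iff.1 hf).2
  exact h.contDiffAt (mem_interior_iff_mem_nhds.1 hp)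

theorem target_mem_nhds {p : M} (hp : extChartAt (𝓡∂ n) p p ∈ interior (range (𝓡∂ n))) :
    (extChartAt (𝓡∂ n) p).target ∈ 𝓝 (extChartAt (𝓡∂ n) p p) := by
  have h := extChartAt_target_mem_nhdsWithin (I := 𝓡∂ n) p
  rwa [nhdsWithin_eq_nhds.2 (mem_interior_iff_mem_nhds.1 hp)] at h

variable [IsManifold (𝓡∂ n) 4 M]

instance contMDiffVectorBundle_tangent_three :
    ContMDiffVectorBundle 3 (EuclideanSpace ℝ (Fin n)) (TangentSpace (𝓡∂ n) : M → Type _)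
      (𝓡∂ n) :=
  haveI : IsManifold (𝓡∂ n) (3 + 1) M := IsManifold.of_le (n := 4) (by norm_num)
  TangentBundle.contMDiffVectorBundle

theorem contMDiffAt_symmL_trivializationAt (p : M) (e : EuclideanSpace ℝ (Fin n)) :
    ContMDiffAt (𝓡∂ n) (𝓡∂ n).tangent 3
      (fun x : M => (⟨x, (trivializationAt (EuclideanSpace ℝ (Fin n))
        (TangentSpace (𝓡∂ n)) p).symmL ℝ x e⟩ : TangentBundle (𝓡∂ n) M)) p := by
  rw [(trivializationAt (EuclideanSpace ℝ (Fin n))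
        (TangentSpace (𝓡∂ n)) p).contMDiffAt_section_iff (mem_baseSet_trivializationAt _ _ p)]
  refine (contMDiffAt_const (c := e)).congr_of_eventuallyEq ?_
  filter_upwards [(trivializationAt (EuclideanSpace ℝ (Fin n))
        (TangentSpace (𝓡∂ n)) p).open_baseSet.mem_nhds (mem_baseSet_trivializationAt _ _ p)]
    with x hx
  rw [Trivialization.symmL_apply _ hx]
  exact congrArg Prod.snd (Trivialization.apply_mk_symm _ hx e)

/-- Coordinate fields are constant in the tangent trivialization, so the bundle-level regularity of
`g` passes to the `g_{ij}`. -/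
theorem coordVec_eq_symmL (p : M) (i : Fin n) {y : EuclideanSpace ℝ (Fin n)}
    (hy : y ∈ (extChartAt (𝓡∂ n) p).target) :
    coordVec p i y = (trivializationAt (EuclideanSpace ℝ (Fin n)) (TangentSpace (𝓡∂ n)) p).symmL ℝ
      ((extChartAt (𝓡∂ n) p).symm y) (EuclideanSpace.single i 1) := by
  have hx : (extChartAt (𝓡∂ n) p).symm y ∈ (chartAt (EuclideanHalfSpace n) p).source := by
    rw [← extChartAt_source (𝓡∂ n)]; exact (extChartAt (𝓡∂ n) p).map_target hy
  rw [TangentBundle.symmL_trivializationAt hx]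
  -- The type of the derivative depends on the base point; `φ` forgets this so that the base point
  -- can be rewritten.
  let φ : EuclideanSpace ℝ (Fin n) → EuclideanSpace ℝ (Fin n) → EuclideanSpace ℝ (Fin n) :=
    fun z v => mfderivWithin 𝓘(ℝ, EuclideanSpace ℝ (Fin n)) (𝓡∂ n) (extChartAt (𝓡∂ n) p).symm
      (range (𝓡∂ n)) z v
  have h : φ y = φ (extChartAt (𝓡∂ n) p ((extChartAt (𝓡∂ n) p).symm y)) := by
    rw [(extChartAt (𝓡∂ n) p).right_inv hy]
  exact congrFun h _

theorem contDiffAt_gMat (g : Metric n M) {p : M}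
    (hp : extChartAt (𝓡∂ n) p p ∈ interior (range (𝓡∂ n))) (i j : Fin n) :
    ContDiffAt ℝ 3 (fun y => gMat g p y i j) (extChartAt (𝓡∂ n) p p) := by
  let s : Fin n → ∀ x : M, TangentSpace (𝓡∂ n) x := fun i x =>
    (trivializationAt (EuclideanSpace ℝ (Fin n)) (TangentSpace (𝓡∂ n)) p).symmL ℝ x
      (EuclideanSpace.single i 1)
  have hF : ContMDiffAt (𝓡∂ n) 𝓘(ℝ, ℝ) 3 (fun x => g.inner x (s i x) (s j x)) p := by
    have : ContMDiffAt (𝓡∂ n) ((𝓡∂ n).prod 𝓘(ℝ, ℝ)) 3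
        (fun x ↦ TotalSpace.mk' ℝ (E := Bundle.Trivial M ℝ) x (g.inner x (s i x) (s j x))) p := by
      apply ContMDiffAt.clm_bundle_apply₂ (F₁ := EuclideanSpace ℝ (Fin n))
        (F₂ := EuclideanSpace ℝ (Fin n))
      · exact g.contMDiff.contMDiffAt
      · exact contMDiffAt_symmL_trivializationAt p _
      · exact contMDiffAt_symmL_trivializationAt p _
    simp only [contMDiffAt_totalSpace] at this
    exact this.2
  refine (contDiffAt_inChart hp hF).congr_of_eventuallyEq ?_
  filter_upwards [target_mem_nhds hp] with y hy
  simp only [gMat, Matrix.of_apply, inChart, s, coordVec_eq_symmL p _ hy]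

theorem gMat_symm (g : Metric n M) (p : M) (y : EuclideanSpace ℝ (Fin n)) (i j : Fin n) :
    gMat g p y i j = gMat g p y j i :=
  g.symm _ _ _

theorem gMat_posDef (g : Metric n M) (p : M) {y : EuclideanSpace ℝ (Fin n)}
    (hy : y ∈ (extChartAt (𝓡∂ n) p).target) : (gMat g p y).PosDef := by
  refine Matrix.PosDef.of_dotProduct_mulVec_pos ?_ fun v hv => ?_
  · ext i j; simp [gMat_symm g p y i j]
  · set L := mfderivWithin 𝓘(ℝ, EuclideanSpace ℝ (Fin n)) (𝓡∂ n) (extChartAt (𝓡∂ n) p).symm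
      (range (𝓡∂ n)) y with hL
    have hinv : L.IsInvertible := isInvertible_mfderivWithin_extChartAt_symm hy
    set V : EuclideanSpace ℝ (Fin n) := ∑ i, v i • EuclideanSpace.single i (1 : ℝ) with hV
    have hV0 : V ≠ 0 := by
      intro h0
      apply hv
      ext i
      have := congrArg (fun w : EuclideanSpace ℝ (Fin n) => w i) h0
      simpa [hV, Pi.single_apply] using this
    have hLV : L V ≠ 0 := by
      intro h0
      exact hV0 (hinv.injective (h0.trans (map_zero L).symm))
    have hpos := g.pos _ (L V) hLV
    have hLe : L V = ∑ i, v i • coordVec p i y := by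
      exact (map_sum L (fun i => v i • EuclideanSpace.single i (1 : ℝ)) Finset.univ).trans
        (Finset.sum_congr rfl fun i _ => map_smul L _ _)
    rw [hLe] at hpos
    refine hpos.trans_eq ?_
    simp only [map_sum, map_smul, sum_apply, smul_apply, smul_eq_mul, dotProduct,
      Matrix.mulVec, star_trivial, Finset.mul_sum, gMat, Matrix.of_apply]
    rw [Finset.sum_comm]
    refine Finset.sum_congr rfl fun i _ => Finset.sum_congr rfl fun j _ => ?_
    simp
    ring

end MetricCoordinates

/-! ### Smoothness of the inverse of a matrix-valued function -/

section MatrixCalculus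

variable {E : Type*} [NormedAddCommGroup E] [NormedSpace ℝ E] {n : ℕ} {m : ℕ∞ω} {y : E}
  {A : E → Matrix (Fin n) (Fin n) ℝ}

theorem contDiffAt_det (hA : ∀ i j, ContDiffAt ℝ m (fun z => A z i j) y) :
    ContDiffAt ℝ m (fun z => (A z).det) y := by
  simp only [Matrix.det_apply']
  exact ContDiffAt.sum fun σ _ => contDiffAt_const.mul (contDiffAt_prod fun i _ => hA _ _)

theorem contDiffAt_inv_apply (hA : ∀ i j, ContDiffAt ℝ m (fun z => A z i j) y)
    (hy : (A y).det ≠ 0) (i j : Fin n) : ContDiffAt ℝ m (fun z => (A z)⁻¹ i j) y := by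
  simp only [Matrix.inv_def, Matrix.smul_apply, smul_eq_mul, Ring.inverse_eq_inv',
    Matrix.adjugate_apply]
  refine ((contDiffAt_det hA).inv hy).mul (contDiffAt_det fun a b => ?_)
  by_cases h : a = j
  · subst h
    simpa using contDiffAt_const
  · simpa [Matrix.updateRow_ne h] using hA a b

end MatrixCalculus

theorem trace_mul_nonneg {n : ℕ} {G P : Matrix (Fin n) (Fin n) ℝ} (hG : G.PosSemidef)
    (hP : P.PosSemidef) : 0 ≤ (G * P).trace := by
  obtain ⟨D, rfl⟩ := exists_eq_conjTranspose_mul_self hG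
  rw [Matrix.mul_assoc, Matrix.trace_mul_comm]
  exact (hP.mul_mul_conjTranspose_same D).trace_nonneg

/-! ### Symmetry of the Ricci tensor and of the Hessian -/

section Symmetry

open Filter Topology

variable {n : ℕ} [NeZero n] {M : Type*} [TopologicalSpace M]
  [ChartedSpace (EuclideanHalfSpace n) M] [IsManifold (𝓡∂ n) 4 M] (g : Metric n M) {p : M}

theorem gMat_inv_symm (p : M) (y : EuclideanSpace ℝ (Fin n)) (i j : Fin n) :
    (gMat g p y)⁻¹ i j = (gMat g p y)⁻¹ j i := by
  have h : (gMat g p y).transpose = gMat g p y := by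
    ext i j; exact gMat_symm g p y j i
  have h2 := Matrix.transpose_nonsing_inv (gMat g p y)
  rw [h] at h2
  exact congrFun (congrFun h2 j) i

theorem christoffel_symm (p : M) (k i j : Fin n) :
    christoffel g p k i j = christoffel g p k j i := by
  funext y
  have h : (fun z => gMat g p z i j) = fun z => gMat g p z j i := by
    funext z; exact gMat_symm g p z i j
  simp only [christoffel, h]
  congr 1
  refine Finset.sum_congr rfl fun l _ => ?_
  ring

/-- The contraction `Γ^k_{ik} = (1/2) g^{kl} ∂_i g_{kl}`. -/
theorem sum_christoffel (p : M) (i : Fin n) (y : EuclideanSpace ℝ (Fin n)) :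
    ∑ k, christoffel g p k i k y
      = (1 / 2) * ∑ k, ∑ l, (gMat g p y)⁻¹ k l * pd i (fun z => gMat g p z k l) y := by
  simp only [christoffel, ← Finset.mul_sum]
  congr 1
  have h : ∑ k, ∑ l, (gMat g p y)⁻¹ k l * pd k (fun z => gMat g p z i l) y
      = ∑ k, ∑ l, (gMat g p y)⁻¹ k l * pd l (fun z => gMat g p z i k) y := by
    rw [Finset.sum_comm]
    refine Finset.sum_congr rfl fun k _ => Finset.sum_congr rfl fun l _ => ?_
    rw [gMat_inv_symm]
  simp only [mul_sub, mul_add, Finset.sum_sub_distrib, Finset.sum_add_distrib, h]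
  ring

theorem det_gMat_ne_zero (p : M) {y : EuclideanSpace ℝ (Fin n)}
    (hy : y ∈ (extChartAt (𝓡∂ n) p).target) : (gMat g p y).det ≠ 0 :=
  (gMat_posDef g p hy).det_pos.ne'

variable (hp : extChartAt (𝓡∂ n) p p ∈ interior (range (𝓡∂ n)))
include hp

theorem contDiffAt_gMat_inv (i j : Fin n) :
    ContDiffAt ℝ 3 (fun y => (gMat g p y)⁻¹ i j) (extChartAt (𝓡∂ n) p p) :=
  contDiffAt_inv_apply (fun i j => contDiffAt_gMat g hp i j)
    (det_gMat_ne_zero g p (mem_extChartAt_target p)) i j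

theorem contDiffAt_pd_gMat (l i j : Fin n) :
    ContDiffAt ℝ 2 (pd l fun y => gMat g p y i j) (extChartAt (𝓡∂ n) p p) :=
  contDiffAt_pd hp l (m := 2) (contDiffAt_gMat g hp i j)

theorem contDiffAt_christoffel (k i j : Fin n) :
    ContDiffAt ℝ 2 (christoffel g p k i j) (extChartAt (𝓡∂ n) p p) := by
  unfold christoffel
  refine contDiffAt_const.mul (ContDiffAt.sum fun l _ => ?_)
  exact ((contDiffAt_gMat_inv g hp k l).of_le (by norm_num)).mul
    (((contDiffAt_pd_gMat g hp i j l).add (contDiffAt_pd_gMat g hp j i l)).sub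
      (contDiffAt_pd_gMat g hp l i j))

/-- The derivative of the inverse metric, `∂ g⁻¹ = -g⁻¹ (∂g) g⁻¹`. -/
theorem pd_gMat_inv (j : Fin n) :
    (Matrix.of fun a b => pd j (fun z => (gMat g p z)⁻¹ a b) (extChartAt (𝓡∂ n) p p))
      = -((gMat g p (extChartAt (𝓡∂ n) p p))⁻¹
        * (Matrix.of fun a b => pd j (fun z => gMat g p z a b) (extChartAt (𝓡∂ n) p p))
        * (gMat g p (extChartAt (𝓡∂ n) p p))⁻¹) := by
  set y := extChartAt (𝓡∂ n) p p with hy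
  set dH : Matrix (Fin n) (Fin n) ℝ :=
    Matrix.of fun a b => pd j (fun z => (gMat g p z)⁻¹ a b) y with hdH
  set dG : Matrix (Fin n) (Fin n) ℝ := Matrix.of fun a b => pd j (fun z => gMat g p z a b) y
    with hdG
  have hmul : dH * gMat g p y + (gMat g p y)⁻¹ * dG = 0 := by
    ext a b
    have h1 : pd j (fun z => ∑ c, (gMat g p z)⁻¹ a c * gMat g p z c b) y = 0 := by
      rw [← pd_const hp j ((1 : Matrix (Fin n) (Fin n) ℝ) a b)]
      apply pd_congr hp
      filter_upwards [target_mem_nhds hp] with z hz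
      rw [← Matrix.mul_apply, Matrix.nonsing_inv_mul _ (det_gMat_ne_zero g p hz).isUnit]
    have hd1 : ∀ a b, DifferentiableAt ℝ (fun z => (gMat g p z)⁻¹ a b) y := fun a b =>
      (contDiffAt_gMat_inv g hp a b).differentiableAt (by norm_num)
    have hd2 : ∀ a b, DifferentiableAt ℝ (fun z => gMat g p z a b) y := fun a b =>
      (contDiffAt_gMat g hp a b).differentiableAt (by norm_num)
    rw [pd_sum hp j _ fun c _ => (hd1 a c).fun_mul (hd2 c b)] at h1
    simp only [fun c => pd_mul hp j (hd1 a c) (hd2 c b), Finset.sum_add_distrib] at h1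
    simpa [Matrix.mul_apply, hdH, hdG] using h1
  have hu : IsUnit (gMat g p y).det := (det_gMat_ne_zero g p (mem_extChartAt_target p)).isUnit
  have h2 := congrArg (fun N => N * (gMat g p y)⁻¹) hmul
  simp only [add_mul, Matrix.mul_assoc, Matrix.mul_nonsing_inv _ hu, Matrix.mul_one,
    Matrix.zero_mul] at h2
  rw [Matrix.mul_assoc]
  exact eq_neg_of_add_eq_zero_left h2

/-- `∂_j Γ^k_{ik}` is symmetric in `i` and `j`. -/
theorem sum_pd_christoffel_symm (i j : Fin n) :
    ∑ k, pd j (christoffel g p k i k) (extChartAt (𝓡∂ n) p p)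
      = ∑ k, pd i (christoffel g p k j k) (extChartAt (𝓡∂ n) p p) := by
  set y := extChartAt (𝓡∂ n) p p with hy
  let H := (gMat g p y)⁻¹
  let dG : Fin n → Matrix (Fin n) (Fin n) ℝ := fun j =>
    Matrix.of fun a b => pd j (fun z => gMat g p z a b) y
  have hd1 : ∀ a b, DifferentiableAt ℝ (fun z => (gMat g p z)⁻¹ a b) y := fun a b =>
    (contDiffAt_gMat_inv g hp a b).differentiableAt (by norm_num)
  have hd2 : ∀ l a b, DifferentiableAt ℝ (pd l fun z => gMat g p z a b) y := fun l a b =>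
    (contDiffAt_pd_gMat g hp l a b).differentiableAt (by norm_num)
  -- Differentiating `½ tr(g⁻¹ ∂_i g)` leaves a trace symmetric by cyclicity and a term with `∂_j
  -- ∂_i g`, symmetric by equality of mixed partials.
  have key : ∀ i j, ∑ k, pd j (christoffel g p k i k) y
      = (1 / 2) * (-(H * dG j * H * dG i).trace
        + ∑ k, ∑ l, H k l * pd j (pd i fun z => gMat g p z k l) y) := by
    intro i j
    have hsum : (fun z => ∑ k, christoffel g p k i k z) = fun z => (1 / 2) * ∑ k, ∑ l,
        (gMat g p z)⁻¹ k l * pd i (fun w => gMat g p w k l) z := by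
      funext z; exact sum_christoffel g p i z
    have hdd : ∀ k l, DifferentiableAt ℝ
        (fun z => (gMat g p z)⁻¹ k l * pd i (fun w => gMat g p w k l) z) y :=
      fun k l => (hd1 k l).mul (hd2 i k l)
    rw [← pd_sum hp j Finset.univ fun k _ =>
      (contDiffAt_christoffel g hp k i k).differentiableAt (by norm_num), hsum,
      pd_const_mul hp j _ (DifferentiableAt.fun_sum fun k _ => DifferentiableAt.fun_sum
        fun l _ => hdd k l),
      pd_sum hp j _ fun k _ => DifferentiableAt.fun_sum fun l _ => hdd k l]
    congr 1
    simp only [fun k => pd_sum hp j Finset.univ fun l _ => hdd k l,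
      fun k l => pd_mul hp j (hd1 k l) (hd2 i k l), Finset.sum_add_distrib]
    congr 1
    rw [← Matrix.trace_neg, ← Matrix.neg_mul, ← pd_gMat_inv g hp j]
    simp only [Matrix.trace, Matrix.diag_apply, Matrix.mul_apply, Matrix.of_apply, dG]
    refine Finset.sum_congr rfl fun k _ => Finset.sum_congr rfl fun l _ => ?_
    have : (fun z => gMat g p z k l) = fun z => gMat g p z l k := by
      funext z; exact gMat_symm g p z k l
    rw [this]
  rw [key i j, key j i]
  congr 2
  · rw [Matrix.mul_assoc (H * dG j), Matrix.trace_mul_comm]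
    simp only [Matrix.mul_assoc]
  · refine Finset.sum_congr rfl fun k _ => Finset.sum_congr rfl fun l _ => ?_
    rw [pd_comm hp j i ((contDiffAt_gMat g hp k l).of_le (by norm_num))]

/-- Only `∂_j Γ^k_{ik}` is not visibly symmetric; the other terms follow from the symmetry of the
lower indices of `Γ`. -/
theorem ricci_symm (i j : Fin n) :
    ricci g p (extChartAt (𝓡∂ n) p p) i j = ricci g p (extChartAt (𝓡∂ n) p p) j i := by
  simp only [ricci, Matrix.of_apply, Finset.sum_sub_distrib]
  rw [sum_pd_christoffel_symm g hp i j]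
  simp only [fun k => christoffel_symm g p k i j]
  congr 2
  rw [Finset.sum_comm]
  refine Finset.sum_congr rfl fun k _ => Finset.sum_congr rfl fun l _ => ?_
  ring

theorem hess_symm {f : M → ℝ} (hf : ContMDiffAt (𝓡∂ n) 𝓘(ℝ, ℝ) 2 f p) (i j : Fin n) :
    hess g f p (extChartAt (𝓡∂ n) p p) i j = hess g f p (extChartAt (𝓡∂ n) p p) j i := by
  simp only [hess, Matrix.of_apply]
  rw [pd_comm hp i j (contDiffAt_inChart hp hf)]
  simp only [fun k => christoffel_symm g p k i j]

theorem barHess_isHermitian {f : M → ℝ} (hf : ContMDiffAt (𝓡∂ n) 𝓘(ℝ, ℝ) 2 f p) :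
    (barHess g f p (extChartAt (𝓡∂ n) p p)).IsHermitian := by
  ext i j
  simp only [Matrix.conjTranspose_apply, star_trivial, barHess, Matrix.of_apply]
  rw [ricci_symm g hp i j, hess_symm g hp hf i j, gMat_symm g p _ i j]
  ring

end Symmetry

/-! ### Comparison at an interior maximum -/

section Comparison

open Filter Topology

variable {n : ℕ} [NeZero n] {M : Type*} [TopologicalSpace M]
  [ChartedSpace (EuclideanHalfSpace n) M] [IsManifold (𝓡∂ n) 4 M] (g : Metric n M) {p : M}

/-- At an interior local maximum of `a - b`, `∇̄² b - ∇̄² a` is positive semidefinite. -/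
theorem exists_posSemidef_barHess_eq (hn : 3 ≤ n)
    (hp : extChartAt (𝓡∂ n) p p ∈ interior (range (𝓡∂ n))) {a b : M → ℝ}
    (ha : ContMDiffAt (𝓡∂ n) 𝓘(ℝ, ℝ) 2 a p) (hb : ContMDiffAt (𝓡∂ n) 𝓘(ℝ, ℝ) 2 b p)
    (hmax : IsLocalMax (fun x => a x - b x) p) :
    ∃ P : Matrix (Fin n) (Fin n) ℝ, P.PosSemidef ∧
      barHess g b p (extChartAt (𝓡∂ n) p p) = barHess g a p (extChartAt (𝓡∂ n) p p) + P := by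
  set y := extChartAt (𝓡∂ n) p p with hy
  have hA : ContDiffAt ℝ 2 (inChart p a) y := contDiffAt_inChart hp ha
  have hB : ContDiffAt ℝ 2 (inChart p b) y := contDiffAt_inChart hp hb
  have hs : (extChartAt (𝓡∂ n) p).symm y = p := extChartAt_to_inv p
  have hmax' : IsLocalMax (fun z => inChart p a z - inChart p b z) y := by
    have hc : Tendsto (extChartAt (𝓡∂ n) p).symm (𝓝 y) (𝓝 p) := by
      have := (continuousAt_extChartAt_symm (I := 𝓡∂ n) p).tendsto
      rwa [extChartAt_to_inv] at this
    have h : ∀ᶠ x in 𝓝 p, a x - b x ≤ a p - b p := hmax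
    filter_upwards [hc.eventually h] with z hz
    simpa only [inChart, hs] using hz
  set D : Matrix (Fin n) (Fin n) ℝ := Matrix.of fun i j =>
    -pd i (pd j fun z => inChart p a z - inChart p b z) y with hD
  have hDpos : D.PosSemidef := posSemidef_neg_pd_pd_of_isLocalMax hp (hA.sub hB) hmax'
  have hgrad : ∀ i, pd i (inChart p a) y = pd i (inChart p b) y := by
    intro i
    have h := pd_sub hp i (hA.differentiableAt two_ne_zero) (hB.differentiableAt two_ne_zero)
    rw [pd_eq_fderiv hp, hmax'.fderiv_eq_zero] at h
    simp only [zero_apply] at h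
    linarith
  have hDe : ∀ i j, D i j = hess g b p y i j - hess g a p y i j := by
    intro i j
    have h1 : pd i (pd j fun z => inChart p a z - inChart p b z) y
        = pd i (pd j (inChart p a)) y - pd i (pd j (inChart p b)) y := by
      have he : (pd j fun z => inChart p a z - inChart p b z)
          =ᶠ[𝓝 y] fun z => pd j (inChart p a) z - pd j (inChart p b) z := by
        filter_upwards [isOpen_interior.mem_nhds hp, hA.eventually (by simp),
          hB.eventually (by simp)] with z hz hz1 hz2
        exact pd_sub hz j (hz1.differentiableAt two_ne_zero) (hz2.differentiableAt two_ne_zero)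
      rw [pd_congr hp i he]
      exact pd_sub hp i ((contDiffAt_pd hp j (m := 1) hA).differentiableAt (by norm_num))
        ((contDiffAt_pd hp j (m := 1) hB).differentiableAt (by norm_num))
    simp only [hD, Matrix.of_apply, hess, h1, hgrad]
    ring
  have hG : (gMat g p y).PosDef := gMat_posDef g p (mem_extChartAt_target p)
  have htr : ((gMat g p y)⁻¹ * D).trace = lap g b p y - lap g a p y := by
    simp only [lap, Matrix.trace, Matrix.diag_apply, Matrix.mul_apply]
    simp only [← Finset.sum_sub_distrib, ← mul_sub, ← hDe]
    refine Finset.sum_congr rfl fun i _ => Finset.sum_congr rfl fun j _ => ?_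
    rw [show D j i = D i j by simpa using hDpos.isHermitian.apply i j]
  have hn' : (3 : ℝ) ≤ n := by exact_mod_cast hn
  -- Equal gradients cancel the quadratic terms, leaving the Hessian and Laplacian parts of `b - a`;
  -- `D` is its Hessian.
  refine ⟨((n : ℝ) - 2) • D + ((gMat g p y)⁻¹ * D).trace • gMat g p y,
    (hDpos.smul (by linarith)).add (hG.posSemidef.smul
      (trace_mul_nonneg hG.inv.posSemidef hDpos)), ?_⟩
  ext i j
  simp only [barHess, Matrix.add_apply, Matrix.smul_apply, smul_eq_mul, Matrix.of_apply, hDe, htr,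
    gradSq, hgrad]
  ring

/-- The logarithms are ordered by monotonicity of `σ_k`, and the zeroth-order term of the speed
supplies `-(a p - b p)`. Only `a` has to lie in the cone. -/
theorem speed_le_of_isLocalMax (hn : 3 ≤ n) {k : ℕ} (hk1 : 1 ≤ k) (hk : k ≤ n)
    (hp : extChartAt (𝓡∂ n) p p ∈ interior (range (𝓡∂ n))) {a b : M → ℝ}
    (ha : ContMDiffAt (𝓡∂ n) 𝓘(ℝ, ℝ) 2 a p) (hb : ContMDiffAt (𝓡∂ n) 𝓘(ℝ, ℝ) 2 b p)
    (hcone : InGammaPlus k (barHessEnd g a p))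
    (hmax : IsLocalMax (fun x => a x - b x) p) :
    speed g k a p ≤ speed g k b p - (a p - b p) := by
  obtain ⟨P, hP, hPe⟩ := exists_posSemidef_barHess_eq g hn hp ha hb hmax
  have hG : (gMat g p (extChartAt (𝓡∂ n) p p)).PosDef := gMat_posDef g p (mem_extChartAt_target p)
  have h := sigma_inv_mul_le hk1 hk hG (barHess_isHermitian g hp ha) hP hcone
  rw [← hPe] at h
  have hlog : Real.log (sigma k (barHessEnd g a p)) ≤ Real.log (sigma k (barHessEnd g b p)) :=
    Real.log_le_log (hcone k hk1 le_rfl) h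
  have hk0 : (0 : ℝ) < k := by exact_mod_cast hk1
  have e : ∀ f : M → ℝ, speed g k f p = 1 / (2 * (k : ℝ)) *
      (Real.log (sigma k (barHessEnd g f p)) - Real.log (betaBar k n)) - f p := by
    intro f; rw [speed]; field_simp
  rw [e, e]
  have : 1 / (2 * (k : ℝ)) *
      (Real.log (sigma k (barHessEnd g a p)) - Real.log (betaBar k n)) ≤ 1 / (2 * (k : ℝ)) *
      (Real.log (sigma k (barHessEnd g b p)) - Real.log (betaBar k n)) := by
    gcongr
  linarith

end Comparison

theorem betaBar_pos {n k : ℕ} (hn : 3 ≤ n) (hkn : k ≤ n) : 0 < betaBar k n := by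
  have h3 : (3 : ℝ) ≤ n := by exact_mod_cast hn
  have h1 : (0 : ℝ) < n - 1 := by linarith
  have h2 : (0 : ℝ) < n.choose k := by exact_mod_cast Nat.choose_pos hkn
  rw [betaBar]; positivity

/-! ### Comparison principle and estimates for the flow. -/

section Flow

open Filter Topology

variable {n : ℕ} [NeZero n] {M : Type*} [TopologicalSpace M]
  [ChartedSpace (EuclideanHalfSpace n) M]

/-- Left difference quotients suffice, so the maximum may sit at the final time. -/
theorem nonneg_of_hasDerivAt_of_forall_le {f : ℝ → ℝ} {d t : ℝ} (hf : HasDerivAt f d t)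
    (ht : 0 < t) (h : ∀ s ∈ Icc 0 t, f s ≤ f t) : 0 ≤ d := by
  have hs : Tendsto (slope f t) (𝓝[<] t) (𝓝 d) :=
    (hasDerivAt_iff_tendsto_slope.1 hf).mono_left
      (nhdsWithin_mono _ fun s (hs : s < t) => hs.ne)
  refine ge_of_tendsto hs ?_
  filter_upwards [Ioo_mem_nhdsLT ht] with s hs
  rw [slope_def_field]
  exact div_nonneg_of_nonpos (by linarith [h s ⟨hs.1.le, hs.2.le⟩]) (by linarith [hs.2])

section AddConst

theorem pd_add_const (i : Fin n) (f : EuclideanSpace ℝ (Fin n) → ℝ) (c : ℝ) :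
    pd i (fun y => f y + c) = pd i f := by
  funext y
  rw [pd, pd, fderivWithin_add_const]

variable [IsManifold (𝓡∂ n) 4 M] (g : Metric n M)

theorem barHessEnd_add_const (f : M → ℝ) (c : ℝ) :
    barHessEnd g (fun z => f z + c) = barHessEnd g f := by
  have h : ∀ (p : M) (i : Fin n), pd i (inChart p fun z => f z + c) = pd i (inChart p f) :=
    fun p i => pd_add_const i (inChart p f) c
  funext x
  simp only [barHessEnd, barHess, lap, gradSq, hess, h]

/-- `∇̄²` sees only derivatives, so a constant enters through the zeroth-order term alone. -/
theorem speed_add_const {k : ℕ} (hk : 1 ≤ k) (f : M → ℝ) (c : ℝ) (x : M) :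
    speed g k (fun z => f z + c) x = speed g k f x - c := by
  have hk0 : (k : ℝ) ≠ 0 := by positivity
  rw [speed, speed, barHessEnd_add_const]
  field_simp
  ring

end AddConst

section Regularity

variable {T : ℝ} {u : M → ℝ → ℝ}

theorem IsC32.hasDerivWithinAt (hu : IsC32 (n := n) T u) (x : M) {t : ℝ} (ht : t ∈ Ico 0 T) :
    HasDerivWithinAt (u x) (dt T u x t) (Ico 0 T) t :=
  (((hu.time x).differentiableOn two_ne_zero) t ht).hasDerivWithinAt

theorem IsC32.hasDerivAt (hu : IsC32 (n := n) T u) (x : M) {t : ℝ} (ht : t ∈ Ioo 0 T) :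
    HasDerivAt (u x) (dt T u x t) t :=
  (hu.hasDerivWithinAt x (Ioo_subset_Ico_self ht)).hasDerivAt (Ico_mem_nhds ht.1 ht.2)

theorem IsC32.continuousOn (hu : IsC32 (n := n) T u) :
    ContinuousOn (fun q : M × ℝ => u q.1 q.2) (univ ×ˢ Ico 0 T) := by
  simpa using hu.continuousOn_time 0 (by norm_num)

theorem IsC32.continuousOn_dt (hu : IsC32 (n := n) T u) :
    ContinuousOn (fun q : M × ℝ => dt T u q.1 q.2) (univ ×ˢ Ico 0 T) := by
  simpa [iteratedDerivWithin_one, dt] using hu.continuousOn_time 1 (by norm_num)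

theorem IsC32.exists_dt_le [CompactSpace M] (hu : IsC32 (n := n) T u) {t : ℝ} (ht : t ∈ Ico 0 T) :
    ∃ C, ∀ x, ∀ s ∈ Icc 0 t, dt T u x s ≤ C := by
  have hK : IsCompact ((univ : Set M) ×ˢ Icc 0 t) := isCompact_univ.prod isCompact_Icc
  obtain ⟨C, hC⟩ := hK.bddAbove_image (hu.continuousOn_dt.mono
    (prod_mono_right fun s hs => ⟨hs.1, hs.2.trans_lt ht.2⟩))
  exact ⟨C, fun x s hs => hC ⟨(x, s), ⟨mem_univ _, hs⟩, rfl⟩⟩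

theorem IsC32.sub_le_mul (hu : IsC32 (n := n) T u) (x : M) {C t : ℝ} (ht : t ∈ Ico 0 T)
    (hC : ∀ s ∈ Icc 0 t, dt T u x s ≤ C) {r s : ℝ} (hr : 0 ≤ r) (hrs : r ≤ s) (hs : s ≤ t) :
    u x s - u x r ≤ C * (s - r) := by
  have hsub : Icc 0 t ⊆ Ico 0 T := fun a ha => ⟨ha.1, ha.2.trans_lt ht.2⟩
  refine (convex_Icc (0 : ℝ) t).image_sub_le_mul_sub_of_deriv_le
    ((hu.time x).continuousOn.mono hsub) ?_ ?_ r ⟨hr, hrs.trans hs⟩ s ⟨hr.trans hrs, hs⟩ hrs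
  · rw [interior_Icc]
    exact fun a ha =>
      (hu.hasDerivAt x ⟨ha.1, ha.2.trans ht.2⟩).differentiableAt.differentiableWithinAt
  · rw [interior_Icc]
    intro a ha
    rw [(hu.hasDerivAt x ⟨ha.1, ha.2.trans ht.2⟩).deriv]
    exact hC a (Ioo_subset_Icc_self ha)

theorem IsC32.monotoneOn (hu : IsC32 (n := n) T u) (x : M)
    (h : ∀ t ∈ Ico 0 T, 0 ≤ dt T u x t) : MonotoneOn (u x) (Ico 0 T) := by
  refine monotoneOn_of_deriv_nonneg (convex_Ico 0 T) (hu.time x).continuousOn ?_ ?_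
  · rw [interior_Ico]
    exact fun a ha => (hu.hasDerivAt x ha).differentiableAt.differentiableWithinAt
  · rw [interior_Ico]
    intro a ha
    rw [(hu.hasDerivAt x ha).deriv]
    exact h a (Ioo_subset_Ico_self ha)

end Regularity

variable [IsManifold (𝓡∂ n) 4 M] {g : Metric n M} {k : ℕ}

theorem IsFlowSolution.dt_eq_speed {T : ℝ} {u : M → ℝ → ℝ} (hk : 1 ≤ k)
    (h : IsFlowSolution g k T u) (x : M) {t : ℝ} (ht : t ∈ Ico 0 T) :
    dt T u x t = speed g k (fun z => u z t) x := by
  have hk0 : (k : ℝ) ≠ 0 := by positivity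
  rw [speed, ← h.eqn x t ht]
  field_simp

/-- A function with `∇̄² f ∈ Γ_k^+` satisfies the subsolution inequality iff its speed is
nonnegative. -/
theorem speed_nonneg_iff (hn : 3 ≤ n) (hk : 1 ≤ k) (hkn : k ≤ n) {f : M → ℝ} {x : M}
    (hcone : InGammaPlus k (barHessEnd g f x)) :
    0 ≤ speed g k f x ↔
      betaBar k n * Real.exp (2 * k * f x) ≤ sigma k (barHessEnd g f x) := by
  have hk0 : (0 : ℝ) < k := by exact_mod_cast hk
  have hβ := betaBar_pos hn hkn
  rw [← Real.log_le_log_iff (by positivity) (hcone k hk le_rfl),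
    Real.log_mul hβ.ne' (Real.exp_pos _).ne', Real.log_exp, speed,
    mul_nonneg_iff_of_pos_left (by positivity)]
  constructor <;> intro h <;> linarith

variable [CompactSpace M]

/-- The parabolic comparison principle. -/
theorem le_of_parabolic_comparison (hn : 3 ≤ n) (hk1 : 1 ≤ k) (hkn : k ≤ n) {τ : ℝ}
    {v w : M → ℝ → ℝ}
    (hcont : ContinuousOn (fun q : M × ℝ => v q.1 q.2 - w q.1 q.2) (univ ×ˢ Icc 0 τ))
    (hv : ∀ t ∈ Ioc 0 τ, ContMDiff (𝓡∂ n) 𝓘(ℝ, ℝ) 2 fun x => v x t)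
    (hw : ∀ t ∈ Ioc 0 τ, ContMDiff (𝓡∂ n) 𝓘(ℝ, ℝ) 2 fun x => w x t)
    (hcone : ∀ x, ∀ t ∈ Ioc 0 τ, InGammaPlus k (barHessEnd g (fun z => v z t) x))
    (hder : ∀ x, ∀ t ∈ Ioc 0 τ, ∃ d, HasDerivAt (fun s => v x s - w x s) d t ∧
      d ≤ speed g k (fun z => v z t) x - speed g k (fun z => w z t) x)
    (h0 : ∀ x, v x 0 ≤ w x 0)
    (hbd : ∀ x ∈ (𝓡∂ n).boundary M, ∀ t ∈ Icc 0 τ, v x t ≤ w x t)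
    (x : M) {t : ℝ} (ht : t ∈ Icc 0 τ) : v x t ≤ w x t := by
  have hK : IsCompact ((univ : Set M) ×ˢ Icc 0 τ) := isCompact_univ.prod isCompact_Icc
  obtain ⟨⟨x₀, t₀⟩, ⟨-, ht₀⟩, hmax⟩ := hK.exists_isMaxOn ⟨(x, t), mem_univ _, ht⟩ hcont
  have hmax' : ∀ y, ∀ s ∈ Icc 0 τ, v y s - w y s ≤ v x₀ t₀ - w x₀ t₀ :=
    fun y s hs => hmax (⟨mem_univ _, hs⟩ : (y, s) ∈ (univ : Set M) ×ˢ Icc 0 τ)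
  by_contra! hlt
  have hpos : 0 < v x₀ t₀ - w x₀ t₀ := by linarith [hmax' x t ht]
  simp only at ht₀
  have ht₀' : t₀ ∈ Ioc 0 τ := by
    refine ⟨lt_of_le_of_ne ht₀.1 fun h => ?_, ht₀.2⟩
    rw [← h] at hpos
    linarith [h0 x₀]
  have hint : extChartAt (𝓡∂ n) x₀ x₀ ∈ interior (range (𝓡∂ n)) := by
    have hx₀ : x₀ ∉ (𝓡∂ n).boundary M := fun h => by linarith [hbd x₀ h t₀ ht₀]
    rw [← ModelWithCorners.compl_interior, notMem_compl_iff] at hx₀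
    exact hx₀
  obtain ⟨d, hd, hdle⟩ := hder x₀ t₀ ht₀'
  have hd0 : 0 ≤ d := nonneg_of_hasDerivAt_of_forall_le hd ht₀'.1
    fun s hs => hmax' x₀ s ⟨hs.1, hs.2.trans ht₀.2⟩
  have hloc : IsLocalMax (fun y => v y t₀ - w y t₀) x₀ :=
    Filter.Eventually.of_forall fun y => hmax' y t₀ ht₀
  -- At the maximum, `0 ≤ d ≤ speed v - speed w ≤ -(v - w) < 0`.
  have := speed_le_of_isLocalMax g hn hk1 hkn hint (hv t₀ ht₀' x₀) (hw t₀ ht₀' x₀)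
    (hcone x₀ t₀ ht₀') hloc
  linarith

section Estimates

variable {T : ℝ} {u₀ : M → ℝ} {u : M → ℝ → ℝ} (hn : 3 ≤ n) (hk1 : 1 ≤ k) (hkn : k ≤ n)
  (hsub : IsSubsolution g k u₀) (hu : IsC32 (n := n) T u) (hflow : IsFlowSolution g k T u)
  (hinit : ∀ x, u x 0 = u₀ x)
include hn hk1 hkn hsub hu hflow hinit

theorem subsolution_le_flow (hmono : ∀ x ∈ (𝓡∂ n).boundary M, MonotoneOn (u x) (Ico 0 T))
    (x : M) {t : ℝ} (ht : t ∈ Ico 0 T) : u₀ x ≤ u x t := by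
  have hI : Icc 0 t ⊆ Ico 0 T := fun a ha => ⟨ha.1, ha.2.trans_lt ht.2⟩
  have hT : 0 < T := ht.1.trans_lt ht.2
  refine le_of_parabolic_comparison (g := g) hn hk1 hkn (τ := t) (v := fun x _ => u₀ x) (w := u)
    ?_ (fun _ _ => hsub.contMDiff)
    (fun s hs => (hu.space s (hI (Ioc_subset_Icc_self hs))).of_le (by norm_num))
    (fun x _ _ => hsub.mem_cone x) (fun x s hs => ?_) (fun x => (hinit x).ge) ?_ x ⟨ht.1, le_rfl⟩
  · exact (hsub.contMDiff.continuous.comp continuous_fst).continuousOn.sub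
      (hu.continuousOn.mono (prod_mono_right hI))
  · refine ⟨-dt T u x s, (hu.hasDerivAt x ⟨hs.1, hs.2.trans_lt ht.2⟩).const_sub _, ?_⟩
    have h1 := (speed_nonneg_iff hn hk1 hkn (hsub.mem_cone x)).2 (hsub.le_sigma x)
    rw [hflow.dt_eq_speed hk1 x (hI (Ioc_subset_Icc_self hs))]
    linarith
  · intro y hy s hs
    rw [← hinit y]
    exact hmono y hy ⟨le_rfl, hT⟩ (hI hs) hs.1

/-- The equation is autonomous, so the translate by `h` also solves it; it starts above `u` because
`u₀ ≤ u(h)`. -/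
theorem flow_monotoneOn (hmono : ∀ x ∈ (𝓡∂ n).boundary M, MonotoneOn (u x) (Ico 0 T)) (x : M) :
    MonotoneOn (u x) (Ico 0 T) := by
  intro r hr s hs hrs
  obtain ⟨h, rfl⟩ : ∃ h, s = r + h := ⟨s - r, by ring⟩
  have hh : 0 ≤ h := by linarith
  have hI : ∀ a ∈ Icc 0 r, a ∈ Ico 0 T := fun a ha => ⟨ha.1, ha.2.trans_lt hr.2⟩
  have hI' : ∀ a ∈ Icc 0 r, a + h ∈ Ico 0 T := fun a ha =>
    ⟨add_nonneg ha.1 hh, by linarith [ha.2, hs.2]⟩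
  refine le_of_parabolic_comparison (g := g) hn hk1 hkn (τ := r) (v := u)
    (w := fun x t => u x (t + h)) ?_
    (fun a ha => (hu.space a (hI a (Ioc_subset_Icc_self ha))).of_le (by norm_num))
    (fun a ha => (hu.space _ (hI' a (Ioc_subset_Icc_self ha))).of_le (by norm_num))
    (fun x a ha => hflow.mem_cone x a (hI a (Ioc_subset_Icc_self ha)))
    (fun x a ha => ?_) (fun x => ?_) ?_ x ⟨hr.1, le_rfl⟩
  · refine (hu.continuousOn.mono (prod_mono_right hI)).sub
      (hu.continuousOn.comp (f := fun q : M × ℝ => (q.1, q.2 + h)) (by fun_prop) ?_)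
    exact fun q hq => ⟨mem_univ _, hI' _ hq.2⟩
  · have ha1 := hI a (Ioc_subset_Icc_self ha)
    have ha2 := hI' a (Ioc_subset_Icc_self ha)
    refine ⟨_, (hu.hasDerivAt x ⟨ha.1, ha1.2⟩).sub
      ((hu.hasDerivAt x (t := a + h) ⟨by linarith [ha.1], ha2.2⟩).comp_add_const a h), ?_⟩
    rw [hflow.dt_eq_speed hk1 x ha1, hflow.dt_eq_speed hk1 x ha2]
  · rw [hinit, zero_add]
    exact subsolution_le_flow hn hk1 hkn hsub hu hflow hinit hmono x
      ⟨hh, by linarith [hr.1, hs.2]⟩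
  · exact fun y hy a ha => hmono y hy (hI a ha) (hI' a ha) (by linarith)

-- The barrier `u₀ + sC` has speed `speed u₀ - sC ≤ C`, which is where `0 ≤ C` enters.
omit hsub in
theorem flow_le_add_mul (hsub₀ : ContMDiff (𝓡∂ n) 𝓘(ℝ, ℝ) 2 u₀) {C t : ℝ} (ht : t ∈ Ico 0 T)
    (hC0 : 0 ≤ C) (hC : ∀ x, speed g k u₀ x ≤ C)
    (hbd : ∀ x ∈ (𝓡∂ n).boundary M, ∀ s ∈ Icc 0 t, dt T u x s ≤ C)
    (x : M) {s : ℝ} (hs : s ∈ Icc 0 t) : u x s ≤ u₀ x + s * C := by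
  have hI : Icc 0 t ⊆ Ico 0 T := fun a ha => ⟨ha.1, ha.2.trans_lt ht.2⟩
  refine le_of_parabolic_comparison (g := g) hn hk1 hkn (τ := t) (v := u)
    (w := fun x s => u₀ x + s * C) ?_
    (fun s hs => (hu.space s (hI (Ioc_subset_Icc_self hs))).of_le (by norm_num))
    (fun s _ => hsub₀.add contMDiff_const)
    (fun x a ha => hflow.mem_cone x a (hI (Ioc_subset_Icc_self ha)))
    (fun x s hs => ?_) (fun x => by simp [hinit]) ?_ x hs
  · refine (hu.continuousOn.mono (prod_mono_right hI)).sub (Continuous.continuousOn ?_)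
    exact (hsub₀.continuous.comp continuous_fst).add (continuous_snd.mul continuous_const)
  · refine ⟨_, (hu.hasDerivAt x ⟨hs.1, hs.2.trans_lt ht.2⟩).sub
      (((hasDerivAt_id s).mul_const C).const_add (u₀ x)), ?_⟩
    rw [hflow.dt_eq_speed hk1 x (hI (Ioc_subset_Icc_self hs)), speed_add_const g hk1]
    have := mul_nonneg hs.1.le hC0
    linarith [hC x]
  · intro y hy s hs
    have := hu.sub_le_mul y ht (hbd y hy) le_rfl hs.1 hs.2
    rw [hinit y] at this
    linarith

omit hsub in
theorem flow_dt_le (hsub₀ : ContMDiff (𝓡∂ n) 𝓘(ℝ, ℝ) 2 u₀) {C t : ℝ} (ht : t ∈ Ico 0 T)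
    (hC0 : 0 ≤ C) (hC : ∀ x, speed g k u₀ x ≤ C)
    (hbd : ∀ x ∈ (𝓡∂ n).boundary M, ∀ s ∈ Icc 0 t, dt T u x s ≤ C) (x : M) :
    dt T u x t ≤ C := by
  rcases ht.1.eq_or_lt with rfl | ht0
  · rw [hflow.dt_eq_speed hk1 x ht, funext hinit]
    exact hC x
  have hI : ∀ a ∈ Icc 0 t, a ∈ Ico 0 T := fun a ha => ⟨ha.1, ha.2.trans_lt ht.2⟩
  -- This says that `r ↦ rC - u x r` is maximal on `[0,t]` at `t`, so its derivative `C - u_t` there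
  -- is nonnegative.
  have key : ∀ r ∈ Icc 0 t, u x t ≤ u x r + (t - r) * C := by
    intro r hr
    obtain ⟨h, rfl⟩ : ∃ h, t = r + h := ⟨t - r, by ring⟩
    have hh : 0 ≤ h := by linarith [hr.2]
    have hIr : ∀ a ∈ Icc 0 r, a ∈ Ico 0 T := fun a ha => hI a ⟨ha.1, ha.2.trans hr.2⟩
    have hI' : ∀ a ∈ Icc 0 r, a + h ∈ Ico 0 T := fun a ha =>
      hI _ ⟨add_nonneg ha.1 hh, by linarith [ha.2]⟩
    rw [add_sub_cancel_left]
    refine le_of_parabolic_comparison (g := g) hn hk1 hkn (τ := r) (v := fun x s => u x (s + h))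
      (w := fun x s => u x s + h * C) ?_
      (fun a ha => (hu.space _ (hI' a (Ioc_subset_Icc_self ha))).of_le (by norm_num))
      (fun a ha => ((hu.space a (hIr a (Ioc_subset_Icc_self ha))).of_le (by norm_num)).add
        contMDiff_const)
      (fun x a ha => hflow.mem_cone x _ (hI' a (Ioc_subset_Icc_self ha)))
      (fun x a ha => ?_) (fun x => ?_) ?_ x ⟨hr.1, le_rfl⟩
    · refine (hu.continuousOn.comp (f := fun q : M × ℝ => (q.1, q.2 + h)) (by fun_prop) ?_).sub
        ((hu.continuousOn.mono (prod_mono_right hIr)).add continuousOn_const)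
      exact fun q hq => ⟨mem_univ _, hI' _ hq.2⟩
    · have ha1 := hIr a (Ioc_subset_Icc_self ha)
      have ha2 := hI' a (Ioc_subset_Icc_self ha)
      refine ⟨_, ((hu.hasDerivAt x (t := a + h) ⟨by linarith [ha.1], ha2.2⟩).comp_add_const a h).sub
        ((hu.hasDerivAt x ⟨ha.1, ha1.2⟩).add_const _), ?_⟩
      rw [hflow.dt_eq_speed hk1 x ha1, hflow.dt_eq_speed hk1 x ha2, speed_add_const g hk1]
      linarith [mul_nonneg hh hC0]
    · rw [hinit, zero_add]
      exact flow_le_add_mul hn hk1 hkn hu hflow hinit hsub₀ ht hC0 hC hbd x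
        ⟨hh, by linarith [hr.1]⟩
    · intro y hy a ha
      have := hu.sub_le_mul y ht (hbd y hy) (r := a) (s := a + h) ha.1 (by linarith)
        (by linarith [ha.2])
      rw [add_sub_cancel_left] at this
      linarith
  have hd := ((hasDerivAt_id t).mul_const C).sub (hu.hasDerivAt x ⟨ht0, ht.2⟩)
  have := nonneg_of_hasDerivAt_of_forall_le hd ht0 fun r hr => by
    simp only [Pi.sub_apply, id]
    linarith [key r hr]
  linarith

end Estimates

end Flow

end SigmaRicci

open SigmaRicci in
theorem lemma3p2 {n : ℕ} [NeZero n] (hn : 3 ≤ n) {k : ℕ} (hk1 : 1 ≤ k) (hkn : k ≤ n)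
    {M : Type*} [TopologicalSpace M] [T2Space M] [CompactSpace M]
    [ChartedSpace (EuclideanHalfSpace n) M] [IsManifold (𝓡∂ n) 4 M]
    (g : SigmaRicci.Metric n M)
    (u₀ : M → ℝ) (hu₀ : ContMDiff (𝓡∂ n) 𝓘(ℝ, ℝ) 3 u₀) (hsub : IsSubsolution g k u₀)
    (T : ℝ) (hT : 0 < T)
    (u : M → ℝ → ℝ) (hu : IsC32 (n := n) T u) (hflow : IsFlowSolution g k T u)
    (hinit : ∀ x, u x 0 = u₀ x)
    (φ : (𝓡∂ n).boundary M → ℝ → ℝ)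
    (hbd : ∀ x : (𝓡∂ n).boundary M, ∀ t ∈ Ico (0 : ℝ) T, u x t = φ x t)
    (hφ : ∀ x : (𝓡∂ n).boundary M, ∀ t ∈ Ico (0 : ℝ) T, 0 ≤ dt T φ x t) :
    -- `u_t ≥ 0`, so `u` is nondecreasing in `t` and stays a subsolution
    (∀ x, ∀ t ∈ Ico (0 : ℝ) T, 0 ≤ dt T u x t) ∧
    (∀ x, MonotoneOn (u x) (Ico (0 : ℝ) T)) ∧
    (∀ t ∈ Ico (0 : ℝ) T, IsSubsolution g k (fun x => u x t)) ∧
    -- the suprema in the bounds are finite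
    BddAbove (range (speed g k u₀)) ∧
    (∀ t ∈ Ico (0 : ℝ) T,
      BddAbove (range fun q : (𝓡∂ n).boundary M × Icc (0 : ℝ) t => dt T φ q.1 q.2)) ∧
    -- upper bound for `u_t`, and the resulting bounds for `u`
    (∀ x, ∀ t ∈ Ico (0 : ℝ) T, dt T u x t ≤ speedBound g k T u₀ φ t) ∧
    (∀ x, ∀ t ∈ Ico (0 : ℝ) T,
      u₀ x ≤ u x t ∧ u x t ≤ u₀ x + t * speedBound g k T u₀ φ t) ∧
    -- the same bounds, uniform on `M × [0,T)`, when `φ_t` is bounded above on `∂M × [0,T)`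
    (∀ B : ℝ, (∀ x : (𝓡∂ n).boundary M, ∀ t ∈ Ico (0 : ℝ) T, dt T φ x t ≤ B) →
      ∀ x, ∀ t ∈ Ico (0 : ℝ) T,
        dt T u x t ≤ max (⨆ z, speed g k u₀ z) B ∧
        u x t ≤ u₀ x + t * max (⨆ z, speed g k u₀ z) B) := by
  have hdtφ : ∀ (x : (𝓡∂ n).boundary M), ∀ t ∈ Ico (0 : ℝ) T, dt T φ x t = dt T u x t :=
    fun x t ht => derivWithin_congr (fun s hs => (hbd x s hs).symm) (hbd x t ht).symm
  have hu₀' : ContMDiff (𝓡∂ n) 𝓘(ℝ, ℝ) 2 u₀ := hsub.contMDiff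
  have hI : ∀ t ∈ Ico (0 : ℝ) T, ∀ s ∈ Icc 0 t, s ∈ Ico (0 : ℝ) T :=
    fun t ht s hs => ⟨hs.1, hs.2.trans_lt ht.2⟩
  have h0T : (0 : ℝ) ∈ Ico (0 : ℝ) T := ⟨le_rfl, hT⟩
  have hmono : ∀ x, MonotoneOn (u x) (Ico (0 : ℝ) T) :=
    flow_monotoneOn hn hk1 hkn hsub hu hflow hinit fun x hx =>
      hu.monotoneOn x fun t ht => (hφ ⟨x, hx⟩ t ht).trans_eq (hdtφ ⟨x, hx⟩ t ht)
  have hdt : ∀ x, ∀ t ∈ Ico (0 : ℝ) T, 0 ≤ dt T u x t :=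
    fun x t _ => (hmono x).derivWithin_nonneg
  have hspeed₀ : ∀ x, 0 ≤ speed g k u₀ x :=
    fun x => (speed_nonneg_iff hn hk1 hkn (hsub.mem_cone x)).2 (hsub.le_sigma x)
  have hbdd : BddAbove (range (speed g k u₀)) := by
    -- The initial speed is `u_t` at `t = 0`, which is bounded by compactness; continuity of
    -- `σ_k(∇̄² u₀)` is not needed.
    obtain ⟨C, hC⟩ := hu.exists_dt_le h0T
    refine ⟨C, ?_⟩
    rintro _ ⟨x, rfl⟩
    have := hC x 0 ⟨le_rfl, le_rfl⟩
    rwa [hflow.dt_eq_speed hk1 x h0T, funext hinit] at this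
  have hbddφ : ∀ t ∈ Ico (0 : ℝ) T,
      BddAbove (range fun q : (𝓡∂ n).boundary M × Icc (0 : ℝ) t => dt T φ q.1 q.2) := by
    intro t ht
    obtain ⟨C, hC⟩ := hu.exists_dt_le ht
    refine ⟨C, ?_⟩
    rintro _ ⟨⟨x, s⟩, rfl⟩
    exact (hdtφ x s (hI t ht s s.2)).trans_le (hC x s s.2)
  have hupper : ∀ C t : ℝ, t ∈ Ico (0 : ℝ) T → (⨆ z, speed g k u₀ z) ≤ C →
      (∀ x : (𝓡∂ n).boundary M, ∀ s ∈ Icc 0 t, dt T φ x s ≤ C) →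
      ∀ x, dt T u x t ≤ C ∧ u x t ≤ u₀ x + t * C := by
    intro C t ht hsup hCφ x
    have hC : ∀ z, speed g k u₀ z ≤ C := fun z => (le_ciSup hbdd z).trans hsup
    have hC0 : 0 ≤ C := (hspeed₀ x).trans (hC x)
    have hb : ∀ x ∈ (𝓡∂ n).boundary M, ∀ s ∈ Icc 0 t, dt T u x s ≤ C := fun x hx s hs =>
      (hdtφ ⟨x, hx⟩ s (hI t ht s hs)).symm.trans_le (hCφ ⟨x, hx⟩ s hs)
    exact ⟨flow_dt_le hn hk1 hkn hu hflow hinit hu₀' ht hC0 hC hb x,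
      flow_le_add_mul hn hk1 hkn hu hflow hinit hu₀' ht hC0 hC hb x ⟨ht.1, le_rfl⟩⟩
  -- If `∂M` is empty, the real supremum over it is `0` by convention; as initial speeds are
  -- nonnegative, the maximum in `speedBound` is unaffected.
  have hC : ∀ t ∈ Ico (0 : ℝ) T, ∀ x, dt T u x t ≤ speedBound g k T u₀ φ t ∧
      u x t ≤ u₀ x + t * speedBound g k T u₀ φ t := fun t ht =>
    hupper _ t ht (le_max_left _ _) fun x s hs =>
      (le_ciSup (hbddφ t ht) (x, ⟨s, hs⟩)).trans (le_max_right _ _)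
  refine ⟨hdt, hmono, fun t ht => ⟨(hu.space t ht).of_le (by norm_num),
    fun x => hflow.mem_cone x t ht, fun x => ?_⟩, hbdd, hbddφ, fun x t ht => (hC t ht x).1,
    fun x t ht => ⟨?_, (hC t ht x).2⟩, fun B hB x t ht => hupper _ t ht (le_max_left _ _)
      (fun y s hs => (hB y s (hI t ht s hs)).trans (le_max_right _ _)) x⟩
  · rw [← speed_nonneg_iff hn hk1 hkn (hflow.mem_cone x t ht), ← hflow.dt_eq_speed hk1 x ht]
    exact hdt x t ht
  · rw [← hinit x]
    exact hmono x h0T ht ht.1
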